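/- **Setting.** Units with speed of light and particle mass equal to one are used. For $\zeta>0$ let $K_n(\zeta)=\int_0^\infty\cosh(n\vartheta)e^{-\zeta\cosh\vartheta}\,d\vartheta$, and for $\ell=0,1$ let $P_n^{(\ell)}(x;\zeta)$, $n\ge 0$, be the polynomial of degree $n$ with positive leading coefficient in the orthonormal family with respect to the weight $\omega^{(\ell)}(x;\zeta)=K_1(\zeta)^{-1}(x^2-1)^{\ell-1/2}e^{-\zeta x}$ on $(1,\infty)$. For $|u|<1$, $\theta>0$, $p\in\mathbb R$ put $\zeta=1/\theta$, $U^0=(1-u^2)^{-1/2}$, $U^1=uU^0$, $p^0=\sqrt{1+p^2}$, $E=U^0p^0-U^1p$, $p_{<1>}=-p+U^1E$, $g_{[u,\theta]}=\frac{1}{2K_1(\zeta)}e^{-E/\theta}$, $$\tilde P^{(0)}_n[u,\theta]=g_{[u,\theta]}P^{(0)}_n(E;\zeta),\qquad \tilde P^{(1)}_n[u,\theta]=g_{[u,\theta]}(U^0)^{-1}P^{(1)}_n(E;\zeta)\,p_{<1>},\qquad \langle f,h\rangle=\int_{\mathbb R}\frac{f(p)h(p)}{g_{[u,\theta]}(p)}\frac{dp}{p^0}.$$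 For $M\ge1$ let $\mathcal P_0,\dots,\mathcal P_{2M}$ denote $\tilde P^{(0)}_0,\tilde P^{(0)}_1,\tilde P^{(1)}_0,\dots,\tilde P^{(0)}_M,\tilde P^{(1)}_{M-1}$ in this order, and let $\Pi_M[u,\theta]f=\sum_{k=0}^{2M}\langle f,\mathcal P_k\rangle\mathcal P_k$. The state vector is $W_M=(\rho,u,\theta,\Pi,\tilde n^1,f^0_3,f^1_2,\dots,f^0_M,f^1_{M-1})\in\mathbb R^{2M+1}$ (for $M=1$ it is $(\rho,u,\theta)$, and $\Pi=\tilde n^1=0$). It represents the distribution function $$F_M(W_M)=\sum_{i=0}^{M}f^0_i\,\tilde P^{(0)}_i[u,\theta]+\sum_{j=0}^{M-1}f^1_j\,\tilde P^{(1)}_j[u,\theta],$$ whose lower coefficients are $f^0_0=\rho/c_0-\Pi\,P^{(0)}_0(0;\zeta)$ with $c_0=P^{(0)}_0$, $f^0_i=-\Pi\,P^{(0)}_i(0;\zeta)$ for $i=1,2$, and $f^1_j=-\tilde n^1P^{(1)}_j(0;\zeta)$ for $j=0,1$. (These values express that $\rho$, $\Pi$ and $\tilde n^1=n^1\sqrt{1-u^2}$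 are the mass density, the bulk viscous pressure and the scaled diffusion current of $F_M$, that $\theta$ is fixed by the energy density of the local equilibrium $\rho g_{[u,\theta]}$, and that $u$ is the velocity in the Landau–Lifshitz frame.) The moment system of order $M$, obtained by operator projection from the one-dimensional relativistic Boltzmann equation $p^0\partial_tf+p\,\partial_xf=Q(f,f)$, is $$B^0_M(W_M)\,\partial_tW_M+B^1_M(W_M)\,\partial_xW_M=S(W_M),$$ where, for $0\le k,j\le 2M$, the entries $(B^0_M)_{kj}$ and $(B^1_M)_{kj}$ are the coefficients at $\mathcal P_k$ of $$\Pi_M[u,\theta]\Big(p^0\,\Pi_M[u,\theta]\frac{\partial F_M}{\partial W_{M,j}}\Big)\quad\text{and}\quad \Pi_M[u,\theta]\Big(p\,\Pi_M[u,\theta]\frac{\partial F_M}{\partial W_{M,j}}\Big),$$ respectively, and the source term $S(W_M)$ contains no derivatives of $W_M$. **Theorem (Hyperbolicity).** For every $M\ge1$ the moment system is strictly hyperbolic on the set of admissible states: for every $W_M$ with $\rho>0$, $|u|<1$, $\theta>0$ and $\Pi>-\rho\theta$, the matrix $B^0_M(W_M)$ is invertible and $B_M=(B^0_M)^{-1}B^1_M$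 has $2M+1$ distinct real eigenvalues. Moreover, for every such state the spectral radius of $B_M$ is less than one. -/

import Mathlib

namespace RelMoment

open Polynomial

noncomputable section

/-- Modified Bessel function of the second kind, `K_n(ζ)`. -/
def besselK (n : ℕ) (ζ : ℝ) : ℝ :=
  ∫ y in Set.Ioi (0 : ℝ), Real.cosh (n * y) * Real.exp (-ζ * Real.cosh y)

/-- The weight `ω^{(ℓ)}(x;ζ) = (x² - 1)^{ℓ - 1/2} exp(-ζ x) / K₁(ζ)` on `(1,∞)`. -/
def weight (l : ℕ) (ζ x : ℝ) : ℝ :=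
  (x ^ 2 - 1) ^ ((l : ℝ) - 1 / 2) / besselK 1 ζ * Real.exp (-ζ * x)

/-- The inner product `(P, Q)_{ω^{(ℓ)}}` of two polynomials. -/
def polyInner (l : ℕ) (ζ : ℝ) (P Q : ℝ[X]) : ℝ :=
  ∫ x in Set.Ioi (1 : ℝ), P.eval x * Q.eval x * weight l ζ x

/-- The orthonormal polynomial `P_n^{(ℓ)}(·;ζ)` of degree `n` with positive leading coefficient,
obtained from `1, x, x², …` by the Gram–Schmidt process. -/
def orthoPoly (l : ℕ) (ζ : ℝ) (n : ℕ) : ℝ[X] :=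
  let Q : ℝ[X] := X ^ n - ∑ k : Fin n,
    C (polyInner l ζ (X ^ n) (orthoPoly l ζ k.1)) * orthoPoly l ζ k.1
  C (Real.sqrt (polyInner l ζ Q Q))⁻¹ * Q
termination_by n
decreasing_by all_goals exact k.2

/-- Velocity component `U⁰`, the Lorentz factor (units `c = m = 1`). -/
def U0 (u : ℝ) : ℝ := (Real.sqrt (1 - u ^ 2))⁻¹

/-- Velocity component `U¹`. -/
def U1 (u : ℝ) : ℝ := u * U0 u

/-- `p⁰ = √(1 + p²)`. -/
def p0 (p : ℝ) : ℝ := Real.sqrt (1 + p ^ 2)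

/-- `E = U_α p^α`. -/
def energy (u p : ℝ) : ℝ := U0 u * p0 p - U1 u * p

/-- `p_{<1>} = Δ_{1β} p^β = g_{1β} p^β - U_1 U_β p^β`, where `U_1 = -U¹`. -/
def pPerp (u p : ℝ) : ℝ := -p + U1 u * energy u p

/-- The equilibrium weight `g⁽⁰⁾_{[u,θ]}`. -/
def g0 (u θ p : ℝ) : ℝ := 1 / (2 * besselK 1 θ⁻¹) * Real.exp (-(energy u p / θ))

/-- The inner product `⟨f, h⟩` with weight `1 / g⁽⁰⁾_{[u,θ]}` and measure `dp / p⁰`. -/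
def inner0 (u θ : ℝ) (f h : ℝ → ℝ) : ℝ :=
  ∫ p : ℝ, 1 / g0 u θ p * f p * h p / p0 p

/-- The basis function `g⁽⁰⁾ P_n^{(0)}(E;ζ)`, with `ζ = 1/θ`. -/
def basisEven (u θ : ℝ) (n : ℕ) (p : ℝ) : ℝ :=
  g0 u θ p * (orthoPoly 0 θ⁻¹ n).eval (energy u p)

/-- The basis function `g⁽⁰⁾ (U⁰)⁻¹ P_n^{(1)}(E;ζ) p_{<1>}`, with `ζ = 1/θ`. -/
def basisOdd (u θ : ℝ) (n : ℕ) (p : ℝ) : ℝ :=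
  g0 u θ p * (U0 u)⁻¹ * (orthoPoly 1 θ⁻¹ n).eval (energy u p) * pPerp u p

/-- The basis in the order `P̃₀⁽⁰⁾, P̃₁⁽⁰⁾, P̃₀⁽¹⁾, P̃₂⁽⁰⁾, P̃₁⁽¹⁾, …` (numbered from `0`): the number
`2n - 1` is `P̃_n⁽⁰⁾` and the number `2n` is `P̃_{n-1}⁽¹⁾`, for `n ≥ 1`. -/
def basisFn (u θ : ℝ) (i : ℕ) : ℝ → ℝ :=
  if i = 0 ∨ i % 2 = 1 then basisEven u θ ((i + 1) / 2) else basisOdd u θ (i / 2 - 1)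

/-- The projection `Π_M[u,θ]` onto the span of the first `2M + 1` basis functions. -/
def proj (M : ℕ) (u θ : ℝ) (f : ℝ → ℝ) (p : ℝ) : ℝ :=
  ∑ i : Fin (2 * M + 1), inner0 u θ f (basisFn u θ i) * basisFn u θ i p

/-- The `k`-th component (numbered from `0`) of a state vector
`W = (ρ, u, θ, Π, ñ¹, f₃⁰, f₂¹, …, f_M⁰, f_{M-1}¹)`; components which `W` does not have
(`Π` and `ñ¹` if `M = 1`) are zero. -/
def comp {M : ℕ} (W : Fin (2 * M + 1) → ℝ) (k : ℕ) : ℝ :=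
  if h : k < 2 * M + 1 then W ⟨k, h⟩ else 0

def density {M : ℕ} (W : Fin (2 * M + 1) → ℝ) : ℝ := comp W 0
def velocity {M : ℕ} (W : Fin (2 * M + 1) → ℝ) : ℝ := comp W 1
def temperature {M : ℕ} (W : Fin (2 * M + 1) → ℝ) : ℝ := comp W 2
def bulkPressure {M : ℕ} (W : Fin (2 * M + 1) → ℝ) : ℝ := comp W 3
def diffusion {M : ℕ} (W : Fin (2 * M + 1) → ℝ) : ℝ := comp W 4

/-- The expansion coefficients `(f₀⁰, f₁⁰, f₀¹, f₂⁰, f₁¹, f₃⁰, f₂¹, …)` in terms of `W`.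
The deviation `δ = f - ρ g⁽⁰⁾` from equilibrium satisfies (integrals with respect to `dp/p⁰`)
`∫ E δ = ∫ E² δ = 0` (matching of mass and energy density), `∫ (E² - 1) δ = Π`,
`∫ (U⁰)⁻¹ p_{<1>} δ = -ñ¹` and `∫ E p_{<1>} δ = 0` (Landau–Lifshitz frame). Hence
`⟨δ, P̃_n⁽⁰⁾⟩ = -Π P_n⁽⁰⁾(0)` for `n ≤ 2` and `⟨δ, P̃_n⁽¹⁾⟩ = -ñ¹ P_n⁽¹⁾(0)` for `n ≤ 1`, while
`ρ g⁽⁰⁾` has the only coefficient `ρ / c₀⁽⁰⁾`, where `c₀⁽⁰⁾` is the constant `P₀⁽⁰⁾`. -/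
def momentCoeff {M : ℕ} (W : Fin (2 * M + 1) → ℝ) : ℕ → ℝ
  | 0 => density W / (orthoPoly 0 (temperature W)⁻¹ 0).leadingCoeff
      - bulkPressure W * (orthoPoly 0 (temperature W)⁻¹ 0).eval 0
  | 1 => -bulkPressure W * (orthoPoly 0 (temperature W)⁻¹ 1).eval 0
  | 2 => -diffusion W * (orthoPoly 1 (temperature W)⁻¹ 0).eval 0
  | 3 => -bulkPressure W * (orthoPoly 0 (temperature W)⁻¹ 2).eval 0
  | 4 => -diffusion W * (orthoPoly 1 (temperature W)⁻¹ 1).eval 0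
  | (i + 5) => comp W (i + 5)

/-- The projected distribution function `Π_M[u,θ] f`, as a function of `W` and `p`. -/
def distribution (M : ℕ) (W : Fin (2 * M + 1) → ℝ) (p : ℝ) : ℝ :=
  ∑ i : Fin (2 * M + 1), momentCoeff W i * basisFn (velocity W) (temperature W) i p

/-- The partial derivative of the projected distribution function with respect to `W_j`. -/
def distributionDeriv (M : ℕ) (W : Fin (2 * M + 1) → ℝ) (j : Fin (2 * M + 1)) (p : ℝ) : ℝ :=
  deriv (fun s => distribution M (Function.update W j s) p) (W j)

/-- The coefficient matrix of the moment system that belongs to the factor `a` (`a = p⁰` for the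
time derivative, `a = p` for the space derivative). Its entry `(k, j)` is the coefficient at the
`k`-th basis function of `Π_M (a Π_M (∂/∂W_j Π_M f))`. -/
def momentMatrix (M : ℕ) (a : ℝ → ℝ) (W : Fin (2 * M + 1) → ℝ) :
    Matrix (Fin (2 * M + 1)) (Fin (2 * M + 1)) ℝ :=
  Matrix.of fun k j =>
    inner0 (velocity W) (temperature W)
      (fun p => a p * proj M (velocity W) (temperature W) (distributionDeriv M W j) p)
      (basisFn (velocity W) (temperature W) k)

/-- The matrix `B⁰_M(W)`. -/
def B0 (M : ℕ) (W : Fin (2 * M + 1) → ℝ) : Matrix (Fin (2 * M + 1)) (Fin (2 * M + 1)) ℝ :=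
  momentMatrix M p0 W

/-- The matrix `B¹_M(W)`. -/
def B1 (M : ℕ) (W : Fin (2 * M + 1) → ℝ) : Matrix (Fin (2 * M + 1)) (Fin (2 * M + 1)) ℝ :=
  momentMatrix M (fun p => p) W

/-- Admissible states: `ρ > 0`, `|u| < 1`, `θ > 0`, `Π > -ρθ`. -/
def Admissible {M : ℕ} (W : Fin (2 * M + 1) → ℝ) : Prop :=
  0 < density W ∧ |velocity W| < 1 ∧ 0 < temperature W ∧
    -(density W * temperature W) < bulkPressure W

/-- A first order system `A⁰(W) ∂_t W + A¹(W) ∂_x W = S(W)` of `n` equations is strictly hyperbolic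
on a set `Ω` of states if at each state `A⁰` is invertible and `(A⁰)⁻¹ A¹` has `n` distinct real
eigenvalues. -/
def IsStrictlyHyperbolicOn {n : ℕ} (A0 A1 : (Fin n → ℝ) → Matrix (Fin n) (Fin n) ℝ)
    (Ω : Set (Fin n → ℝ)) : Prop :=
  ∀ W ∈ Ω, IsUnit (A0 W) ∧
    ∃ lam : Fin n → ℝ, StrictMono lam ∧
      ∀ i, Module.End.HasEigenvalue (Matrix.toLin' ((A0 W)⁻¹ * A1 W)) (lam i)

end

end RelMoment

/-!
With `p = sinh y` and the rapidity `x` of a particle relative to the mean velocity `u = tanh η`, the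
basis functions become `cosh`-polynomials, or `sinh` times `cosh`-polynomials, in `x` and span the
Laurent polynomials of degree `≤ M` in `exp x`, while `p⁰ = cosh (x + η)` and `p = sinh (x + η)`.
Thus `B⁰ = G(cosh (x + η)) D` and `B¹ = G(sinh (x + η)) D`, where `G(a)` is the Gram matrix with
weight `a` and `D` is the matrix of coefficients of the derivatives of the distribution function.

The pencil of the two symmetric matrices is definite, and `p⁰ ± p > 0` puts its eigenvalues in
`(-1, 1)`. They are simple: for `c = tanh (x₀ + η)` the weight `p - c p⁰` changes sign exactly at
`x₀`, and an element `h` of the kernel of `G(p - c p⁰)` that vanishes at `x₀` is orthogonal to the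
Laurent polynomial `h / (exp x - exp x₀)`, which makes the integral of a nonnegative function
vanish; so `h = 0` and the kernel is at most one-dimensional.

The matrix `D` is invertible because suitable moments of the distribution function determine `W` to
first order. The two nontrivial steps are the derivative in `θ`, which is nonzero by the strict
Cauchy–Schwarz inequality, and the derivative in `u`, which is nonzero because `Π > -ρ θ`.
-/

namespace RelMoment

open Polynomial MeasureTheory Matrix

noncomputable section

/-! ### Definite pencils -/

section Pencil

variable {n : Type*} [Fintype n] [DecidableEq n]

theorem exists_conjTranspose_mul_self_and_diagonal {A B : Matrix n n ℝ} (hA : A.PosDef)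
    (hB : B.IsHermitian) :
    ∃ (Q : Matrix n n ℝ) (d : n → ℝ), IsUnit Q ∧ A = Qᴴ * Q ∧ B = Qᴴ * diagonal d * Q := by
  obtain ⟨S, hS, rfl⟩ : ∃ S : Matrix n n ℝ, IsUnit S ∧ A = Sᴴ * S := by
    open scoped MatrixOrder Matrix.Norms.L2Operator in
    exact CStarAlgebra.isStrictlyPositive_iff_eq_star_mul_self.mp hA.isStrictlyPositive
  have hS' : IsUnit S.det := S.isUnit_iff_isUnit_det.mp hS
  have hT : ((S⁻¹)ᴴ * B * S⁻¹).IsHermitian := isHermitian_conjTranspose_mul_mul _ hB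
  set U : Matrix n n ℝ := hT.eigenvectorUnitary.val
  have hU : Uᴴ * U = 1 := Unitary.coe_star_mul_self hT.eigenvectorUnitary
  have hU' : U * Uᴴ = 1 := Unitary.coe_mul_star_self hT.eigenvectorUnitary
  have hdiag : U * diagonal hT.eigenvalues * Uᴴ = (S⁻¹)ᴴ * B * S⁻¹ := hT.spectral_theorem.symm
  refine ⟨Uᴴ * S, hT.eigenvalues, (IsUnit.of_mul_eq_one _ hU).mul hS, ?_, ?_⟩
  · rw [conjTranspose_mul, conjTranspose_conjTranspose, Matrix.mul_assoc, ← Matrix.mul_assoc U, hU',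
      Matrix.one_mul]
  · calc B = (S⁻¹ * S)ᴴ * B * (S⁻¹ * S) := by simp [nonsing_inv_mul _ hS']
      _ = Sᴴ * (U * diagonal hT.eigenvalues * Uᴴ) * S := by
        rw [hdiag]; simp only [conjTranspose_mul, Matrix.mul_assoc]
      _ = (Uᴴ * S)ᴴ * diagonal hT.eigenvalues * (Uᴴ * S) := by
        simp only [conjTranspose_mul, conjTranspose_conjTranspose, Matrix.mul_assoc]

theorem abs_lt_one_of_posDef_add_of_posDef_sub {Q : Matrix n n ℝ} {d : n → ℝ} (hQ : IsUnit Q)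
    (hadd : (Qᴴ * Q + Qᴴ * diagonal d * Q).PosDef)
    (hsub : (Qᴴ * Q - Qᴴ * diagonal d * Q).PosDef) (i : n) : |d i| < 1 := by
  have hadd' : (diagonal fun i => 1 + d i).PosDef := by
    rw [← hQ.posDef_star_left_conjugate_iff, ← diagonal_add, diagonal_one]
    simpa only [mul_add, add_mul, mul_one, star_eq_conjTranspose] using hadd
  have hsub' : (diagonal fun i => 1 - d i).PosDef := by
    rw [← hQ.posDef_star_left_conjugate_iff, ← diagonal_sub, diagonal_one]
    simpa only [mul_sub, sub_mul, mul_one, star_eq_conjTranspose] using hsub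
  exact abs_lt.mpr ⟨by linarith [posDef_diagonal_iff.mp hadd' i],
    by linarith [posDef_diagonal_iff.mp hsub' i]⟩

theorem diagonal_injective_of_exists_functional {Q : Matrix n n ℝ} {d : n → ℝ} (hQ : IsUnit Q)
    (hker : ∀ i, ∃ φ : (n → ℝ) →ₗ[ℝ] ℝ, ∀ v,
      (Qᴴ * diagonal d * Q - d i • (Qᴴ * Q)) *ᵥ v = 0 → φ v = 0 → v = 0) :
    Function.Injective d := by
  intro i j hij
  by_contra hne
  have hQ' : IsUnit Q.det := Q.isUnit_iff_isUnit_det.mp hQ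
  obtain ⟨φ, hφ⟩ := hker i
  have hcol : ∀ k, d k = d i →
      (Qᴴ * diagonal d * Q - d i • (Qᴴ * Q)) *ᵥ (Q⁻¹ *ᵥ Pi.single k 1) = 0 := by
    intro k hk
    rw [← hk, ← Matrix.smul_mul, ← Matrix.sub_mul, mulVec_mulVec,
      mul_nonsing_inv_cancel_right _ _ hQ', sub_mulVec, ← mulVec_mulVec, diagonal_mulVec_single,
      smul_mulVec, ← mulVec_smul, ← Pi.single_smul', mul_one, smul_eq_mul, mul_one, sub_self]
  have hQQ : ∀ x, Q *ᵥ (Q⁻¹ *ᵥ x) = x := fun x => by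
    rw [mulVec_mulVec, mul_nonsing_inv _ hQ', one_mulVec]
  set v := Q⁻¹ *ᵥ (Pi.single i 1 : n → ℝ)
  set w := Q⁻¹ *ᵥ (Pi.single j 1 : n → ℝ)
  have hvw : φ w • v - φ v • w = 0 := hφ _
    (by rw [mulVec_sub, mulVec_smul, mulVec_smul, hcol i rfl, hcol j hij.symm]; simp)
    (by simp [mul_comm])
  have hsingle : φ w • Pi.single i 1 - φ v • Pi.single j 1 = (0 : n → ℝ) := by
    simpa only [mulVec_sub, mulVec_smul, hQQ, v, w, mulVec_zero] using congrArg (Q *ᵥ ·) hvw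
  have hw : w = 0 := hφ w (hcol j hij.symm) (by simpa [hne] using congrFun hsingle i)
  have : (Pi.single j 1 : n → ℝ) = 0 := by
    simpa only [hQQ, w, mulVec_zero] using congrArg (Q *ᵥ ·) hw
  simpa using congrFun this j

theorem exists_inv_mul_eq_conj_diagonal {A B D : Matrix n n ℝ} (hA : A.PosDef)
    (hB : B.IsHermitian) (hadd : (A + B).PosDef) (hsub : (A - B).PosDef) (hD : IsUnit D)
    (hker : ∀ c : ℝ, |c| < 1 → ∃ φ : (n → ℝ) →ₗ[ℝ] ℝ, ∀ v,
      (B - c • A) *ᵥ v = 0 → φ v = 0 → v = 0) :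
    ∃ (P : (Matrix n n ℝ)ˣ) (d : n → ℝ), Function.Injective d ∧ (∀ i, |d i| < 1) ∧
      (A * D)⁻¹ * (B * D) = P⁻¹ * diagonal d * P := by
  obtain ⟨Q, d, hQ, rfl, rfl⟩ := exists_conjTranspose_mul_self_and_diagonal hA hB
  have hd := abs_lt_one_of_posDef_add_of_posDef_sub hQ hadd hsub
  have hQ' : IsUnit Qᴴ.det := (isUnit_iff_isUnit_det _).mp hQ.star
  refine ⟨(hQ.mul hD).unit, d,
    diagonal_injective_of_exists_functional hQ fun i => hker _ (hd i), hd, ?_⟩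
  rw [coe_units_inv, IsUnit.unit_spec]
  simp only [Matrix.mul_inv_rev, Matrix.mul_assoc, nonsing_inv_mul_cancel_left _ _ hQ']

theorem spectrum_conj_diagonal {K : Type*} [Field K] (P : (Matrix n n K)ˣ) (d : n → K) :
    spectrum K ((P⁻¹ : (Matrix n n K)ˣ) * diagonal d * P : Matrix n n K) = Set.range d := by
  rw [spectrum.units_conjugate', spectrum_diagonal]

theorem exists_strictMono_hasEigenvalue {N : ℕ} {K : Type*} [Field K] [LinearOrder K]
    {A : Matrix (Fin N) (Fin N) K} {d : Fin N → K} (hd : Function.Injective d)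
    (hA : spectrum K A = Set.range d) :
    ∃ lam : Fin N → K, StrictMono lam ∧ ∀ i, Module.End.HasEigenvalue (toLin' A) (lam i) := by
  refine ⟨d ∘ Tuple.sort d,
    (Tuple.monotone_sort d).strictMono_of_injective (hd.comp (Tuple.sort d).injective), fun i => ?_⟩
  rw [Module.End.hasEigenvalue_iff_mem_spectrum, spectrum_toLin', hA]
  exact Set.mem_range_self _

theorem spectralRadius_lt_one_of_spectrum_eq_range {𝕜 R ι : Type*} [NormedField 𝕜] [Ring R]
    [Algebra 𝕜 R] [Finite ι] {a : R} {d : ι → 𝕜} (ha : spectrum 𝕜 a = Set.range d)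
    (hd : ∀ i, ‖d i‖ < 1) : spectralRadius 𝕜 a < 1 := by
  cases nonempty_fintype ι
  rw [spectralRadius, ha, iSup_range, ← Finset.sup_univ_eq_iSup, Finset.sup_lt_iff (by simp)]
  exact fun i _ => by exact_mod_cast hd i

theorem spectralRadius_map_conj_diagonal_lt_one (P : (Matrix n n ℝ)ˣ) {d : n → ℝ}
    (hd : ∀ i, |d i| < 1) :
    spectralRadius ℂ (((P⁻¹ : (Matrix n n ℝ)ˣ) * diagonal d * P : Matrix n n ℝ).map
      (algebraMap ℝ ℂ)) < 1 := by
  let f : Matrix n n ℝ →* Matrix n n ℂ := (algebraMap ℝ ℂ).mapMatrix.toMonoidHom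
  have hmap : ((P⁻¹ : (Matrix n n ℝ)ˣ) * diagonal d * P : Matrix n n ℝ).map (algebraMap ℝ ℂ) =
      ((Units.map f P)⁻¹ : (Matrix n n ℂ)ˣ) * diagonal (fun i => (d i : ℂ)) * Units.map f P := by
    change f (_ * _ * _) = _
    rw [map_mul, map_mul, ← map_inv]
    simp [f, diagonal_map]
  rw [hmap]
  exact spectralRadius_lt_one_of_spectrum_eq_range (spectrum_conj_diagonal _ _)
    fun i => by simpa using hd i

end Pencil

/-! ### Polynomials in `exp x` and `exp (-x)` -/

/-- The algebra of functions generated by `exp x` and `exp (-x)`. In the rapidity variable all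
functions of the moment system are an exponentially small weight times an element of it. -/
def expAlgebra : Subalgebra ℝ (ℝ → ℝ) :=
  Algebra.adjoin ℝ {Real.exp, fun x => Real.exp (-x)}

theorem exp_mem_expAlgebra : Real.exp ∈ expAlgebra := Algebra.subset_adjoin (by simp)

theorem exp_neg_mem_expAlgebra : (fun x => Real.exp (-x)) ∈ expAlgebra :=
  Algebra.subset_adjoin (by simp)

theorem cosh_mem_expAlgebra : Real.cosh ∈ expAlgebra := by
  have h : Real.cosh = (1 / 2 : ℝ) • (Real.exp + fun x => Real.exp (-x)) := by
    ext x
    simp only [Real.cosh_eq, Pi.smul_apply, Pi.add_apply, smul_eq_mul]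
    ring
  exact h ▸ expAlgebra.smul_mem (expAlgebra.add_mem exp_mem_expAlgebra exp_neg_mem_expAlgebra) _

theorem sinh_mem_expAlgebra : Real.sinh ∈ expAlgebra := by
  have h : Real.sinh = (1 / 2 : ℝ) • (Real.exp - fun x => Real.exp (-x)) := by
    ext x
    simp only [Real.sinh_eq, Pi.smul_apply, Pi.sub_apply, smul_eq_mul]
    ring
  exact h ▸ expAlgebra.smul_mem (expAlgebra.sub_mem exp_mem_expAlgebra exp_neg_mem_expAlgebra) _

theorem aeval_mem_expAlgebra {f : ℝ → ℝ} (hf : f ∈ expAlgebra) (P : ℝ[X]) :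
    aeval f P ∈ expAlgebra :=
  Algebra.adjoin_le (Set.singleton_subset_iff.mpr hf) (aeval_mem_adjoin_singleton ℝ f)

theorem differentiable_of_mem_expAlgebra {f : ℝ → ℝ} (hf : f ∈ expAlgebra) :
    Differentiable ℝ f := by
  induction hf using Algebra.adjoin_induction with
  | mem f hf => rcases hf with rfl | rfl <;> fun_prop
  | algebraMap c => exact differentiable_const c
  | add f g _ _ hf hg => exact hf.add hg
  | mul f g _ _ hf hg => exact hf.mul hg

theorem deriv_mem_expAlgebra {f : ℝ → ℝ} (hf : f ∈ expAlgebra) : deriv f ∈ expAlgebra := by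
  induction hf using Algebra.adjoin_induction with
  | mem f hf =>
    rcases hf with rfl | rfl
    · rw [Real.deriv_exp]
      exact exp_mem_expAlgebra
    · have : deriv (fun x => Real.exp (-x)) = -fun x => Real.exp (-x) := by
        ext x; simp [deriv_comp_neg Real.exp]
      exact this ▸ expAlgebra.neg_mem exp_neg_mem_expAlgebra
  | algebraMap c =>
    have : deriv (algebraMap ℝ (ℝ → ℝ) c) = 0 := deriv_const' c
    exact this ▸ expAlgebra.zero_mem
  | add f g hf hg hf' hg' =>
    have : deriv (f + g) = deriv f + deriv g := funext fun x =>
      deriv_add (differentiable_of_mem_expAlgebra hf x) (differentiable_of_mem_expAlgebra hg x)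
    exact this ▸ expAlgebra.add_mem hf' hg'
  | mul f g hf hg hf' hg' =>
    have : deriv (f * g) = deriv f * g + f * deriv g := funext fun x =>
      deriv_mul (differentiable_of_mem_expAlgebra hf x) (differentiable_of_mem_expAlgebra hg x)
    exact this ▸ expAlgebra.add_mem (expAlgebra.mul_mem hf' hg) (expAlgebra.mul_mem hf hg')

theorem exists_abs_le_mul_cosh_pow {f : ℝ → ℝ} (hf : f ∈ expAlgebra) :
    ∃ (C : ℝ) (n : ℕ), 0 ≤ C ∧ ∀ x, |f x| ≤ C * Real.cosh x ^ n := by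
  induction hf using Algebra.adjoin_induction with
  | mem f hf =>
    rcases hf with rfl | rfl <;>
    · refine ⟨2, 1, by norm_num, fun x => ?_⟩
      rw [abs_of_pos (Real.exp_pos _), Real.cosh_eq]
      linarith [Real.exp_pos x, Real.exp_pos (-x)]
  | algebraMap c => exact ⟨|c|, 0, abs_nonneg c, fun x => by simp⟩
  | add f g _ _ hf hg =>
    obtain ⟨C, m, hC, hf⟩ := hf
    obtain ⟨D, n, hD, hg⟩ := hg
    refine ⟨C + D, max m n, by positivity, fun x => ?_⟩
    calc |f x + g x| ≤ C * Real.cosh x ^ m + D * Real.cosh x ^ n :=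
          (abs_add_le _ _).trans (add_le_add (hf x) (hg x))
      _ ≤ C * Real.cosh x ^ max m n + D * Real.cosh x ^ max m n := by
        gcongr <;> simp
      _ = (C + D) * Real.cosh x ^ max m n := by ring
  | mul f g _ _ hf hg =>
    obtain ⟨C, m, hC, hf⟩ := hf
    obtain ⟨D, n, hD, hg⟩ := hg
    refine ⟨C * D, m + n, by positivity, fun x => ?_⟩
    calc |f x * g x| = |f x| * |g x| := abs_mul _ _
      _ ≤ (C * Real.cosh x ^ m) * (D * Real.cosh x ^ n) := by
        gcongr
        · exact hf x
        · exact hg x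
      _ = C * D * Real.cosh x ^ (m + n) := by ring

theorem sq_div_four_le_cosh (x : ℝ) : x ^ 2 / 4 ≤ Real.cosh x := by
  rw [← Real.cosh_abs, Real.cosh_eq, ← sq_abs]
  linarith [Real.quadratic_le_exp_of_nonneg (abs_nonneg x), Real.add_one_le_exp (-|x|)]

theorem integrable_cosh_pow_mul_exp (n : ℕ) {ζ : ℝ} (hζ : 0 < ζ) :
    Integrable fun x => Real.cosh x ^ n * Real.exp (-ζ * Real.cosh x) := by
  refine ((integrable_exp_neg_mul_sq (b := ζ / 8) (by positivity)).const_mul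
    (n.factorial / (ζ / 2) ^ n)).mono' (by fun_prop) (ae_of_all _ fun x => ?_)
  have hpow : Real.cosh x ^ n ≤ n.factorial / (ζ / 2) ^ n * Real.exp (ζ / 2 * Real.cosh x) := by
    have := Real.pow_div_factorial_le_exp (ζ / 2 * Real.cosh x) (by positivity) n
    rw [div_le_iff₀ (by positivity), mul_pow] at this
    rw [div_mul_eq_mul_div, le_div_iff₀ (by positivity)]
    linarith
  calc ‖Real.cosh x ^ n * Real.exp (-ζ * Real.cosh x)‖
      = Real.cosh x ^ n * Real.exp (-ζ * Real.cosh x) := Real.norm_of_nonneg (by positivity)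
    _ ≤ n.factorial / (ζ / 2) ^ n * Real.exp (ζ / 2 * Real.cosh x) *
        Real.exp (-ζ * Real.cosh x) := by gcongr
    _ = n.factorial / (ζ / 2) ^ n * Real.exp (-(ζ / 2) * Real.cosh x) := by
      rw [mul_assoc, ← Real.exp_add]; ring_nf
    _ ≤ n.factorial / (ζ / 2) ^ n * Real.exp (-(ζ / 8) * x ^ 2) := by
      refine mul_le_mul_of_nonneg_left (Real.exp_le_exp.mpr ?_) (by positivity)
      nlinarith [sq_div_four_le_cosh x]

theorem integrable_mul_exp_of_mem_expAlgebra {f : ℝ → ℝ} (hf : f ∈ expAlgebra) {ζ : ℝ}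
    (hζ : 0 < ζ) : Integrable fun x => f x * Real.exp (-ζ * Real.cosh x) := by
  obtain ⟨C, n, -, hC⟩ := exists_abs_le_mul_cosh_pow hf
  have hf' := (differentiable_of_mem_expAlgebra hf).continuous
  refine ((integrable_cosh_pow_mul_exp n hζ).const_mul C).mono' (by fun_prop)
    (ae_of_all _ fun x => ?_)
  rw [norm_mul, Real.norm_of_nonneg (Real.exp_pos _).le, ← mul_assoc]
  gcongr
  exact hC x

/-- The Laurent polynomials in `exp x` with exponents between `-N` and `N`. -/
def laurent (N : ℕ) : Submodule ℝ (ℝ → ℝ) :=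
  (degreeLT ℝ (2 * N + 1)).map
    (LinearMap.mulLeft ℝ ((fun x => Real.exp (-x)) ^ N) ∘ₗ (aeval Real.exp).toLinearMap)

theorem mem_laurent {N : ℕ} {f : ℝ → ℝ} :
    f ∈ laurent N ↔
      ∃ Q : ℝ[X], Q.natDegree ≤ 2 * N ∧ ∀ x, f x = Real.exp (-x) ^ N * Q.eval (Real.exp x) := by
  have hdeg : ∀ Q : ℝ[X], Q ∈ degreeLT ℝ (2 * N + 1) ↔ Q.natDegree ≤ 2 * N := fun Q => by
    rw [mem_degreeLT, natDegree_le_iff_degree_le, degree_lt_iff_coeff_zero,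
      degree_le_iff_coeff_zero]
    norm_cast
  simp only [laurent, Submodule.mem_map, hdeg]
  refine exists_congr fun Q => and_congr_right fun _ => ?_
  rw [eq_comm, funext_iff]
  simp [aeval_fn_apply]

theorem laurent_le_expAlgebra (N : ℕ) : laurent N ≤ expAlgebra.toSubmodule := by
  rintro _ ⟨Q, -, rfl⟩
  exact expAlgebra.mul_mem (expAlgebra.pow_mem exp_neg_mem_expAlgebra N)
    (aeval_mem_expAlgebra exp_mem_expAlgebra Q)

theorem mul_mem_laurent {M N : ℕ} {f g : ℝ → ℝ} (hf : f ∈ laurent M) (hg : g ∈ laurent N) :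
    f * g ∈ laurent (M + N) := by
  obtain ⟨P, hP, hf⟩ := mem_laurent.mp hf
  obtain ⟨Q, hQ, hg⟩ := mem_laurent.mp hg
  refine mem_laurent.mpr ⟨P * Q, by linarith [natDegree_mul_le (p := P) (q := Q)], fun x => ?_⟩
  rw [Pi.mul_apply, hf, hg, eval_mul]
  ring

theorem one_mem_laurent (N : ℕ) : 1 ∈ laurent N := by
  refine mem_laurent.mpr ⟨X ^ N, by rw [natDegree_X_pow]; omega, fun x => ?_⟩
  simp [← mul_pow, ← Real.exp_add]

theorem laurent_mono : Monotone laurent := by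
  intro M N h f hf
  obtain ⟨k, rfl⟩ := Nat.exists_eq_add_of_le h
  simpa using mul_mem_laurent hf (one_mem_laurent k)

theorem cosh_mem_laurent : Real.cosh ∈ laurent 1 := by
  refine mem_laurent.mpr ⟨C (1 / 2) * (X ^ 2 + 1), by compute_degree, fun x => ?_⟩
  have h : Real.exp (-x) * Real.exp x = 1 := by rw [← Real.exp_add]; simp
  simp only [Real.cosh_eq, eval_mul, eval_C, eval_add, eval_pow, eval_X, eval_one]
  linear_combination -(1 / 2) * Real.exp x * h

theorem sinh_mem_laurent : Real.sinh ∈ laurent 1 := by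
  refine mem_laurent.mpr ⟨C (1 / 2) * (X ^ 2 - 1), by compute_degree, fun x => ?_⟩
  have h : Real.exp (-x) * Real.exp x = 1 := by rw [← Real.exp_add]; simp
  simp only [Real.sinh_eq, eval_mul, eval_C, eval_sub, eval_pow, eval_X, eval_one]
  linear_combination -(1 / 2) * Real.exp x * h

theorem cosh_pow_mem_laurent (n : ℕ) : Real.cosh ^ n ∈ laurent n := by
  induction n with
  | zero => simpa using one_mem_laurent 0
  | succ n ih => simpa only [pow_succ] using mul_mem_laurent ih cosh_mem_laurent

theorem aeval_cosh_mem_laurent (P : ℝ[X]) : aeval Real.cosh P ∈ laurent P.natDegree := by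
  rw [aeval_eq_sum_range]
  exact Submodule.sum_mem _ fun i hi => Submodule.smul_mem _ _
    (laurent_mono (Finset.mem_range_succ_iff.mp hi) (cosh_pow_mem_laurent i))

theorem exists_mem_laurent_eq_exp_sub_mul {N : ℕ} {f : ℝ → ℝ} (hf : f ∈ laurent N) {x₀ : ℝ}
    (h₀ : f x₀ = 0) : ∃ g ∈ laurent N, ∀ x, f x = (Real.exp x - Real.exp x₀) * g x := by
  obtain ⟨Q, hQ, hf⟩ := mem_laurent.mp hf
  have hroot : Q.IsRoot (Real.exp x₀) :=
    (mul_eq_zero.mp ((hf x₀).symm.trans h₀)).resolve_left (by positivity)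
  have hdvd := mul_divByMonic_eq_iff_isRoot.mpr hroot
  refine ⟨_, mem_laurent.mpr ⟨Q /ₘ (X - C (Real.exp x₀)),
    (natDegree_divByMonic Q (monic_X_sub_C _)).trans_le (by omega), fun _ => rfl⟩, fun x => ?_⟩
  have heval := congrArg (eval (Real.exp x)) hdvd
  rw [eval_mul, eval_sub, eval_X, eval_C] at heval
  rw [hf, ← heval]
  ring

theorem finrank_laurent_le (N : ℕ) : Module.finrank ℝ (laurent N) ≤ 2 * N + 1 := by
  have : Module.Finite ℝ (degreeLT ℝ (2 * N + 1)) := .equiv (degreeLTEquiv ℝ _).symm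
  exact (Submodule.finrank_map_le _ _).trans (by simp [(degreeLTEquiv ℝ (2 * N + 1)).finrank_eq])

instance (N : ℕ) : Module.Finite ℝ (laurent N) := by
  have : Module.Finite ℝ (degreeLT ℝ (2 * N + 1)) := .equiv (degreeLTEquiv ℝ _).symm
  exact .map _ _

/-! ### Averages with respect to the Jüttner distribution -/

/-- The Jüttner distribution as a function of the rapidity relative to the fluid. -/
def juttner (ζ x : ℝ) : ℝ := Real.exp (-ζ * Real.cosh x) / (2 * besselK 1 ζ)

/-- The integral `⟨f⟩` of `f` against the Jüttner distribution, over all rapidities. It is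
normalized by `⟨cosh⟩ = 1` rather than by `⟨1⟩ = 1`. -/
def avg (ζ : ℝ) (f : ℝ → ℝ) : ℝ := ∫ x, f x * juttner ζ x

theorem avg_eq_div (ζ : ℝ) (f : ℝ → ℝ) :
    avg ζ f = (∫ x, f x * Real.exp (-ζ * Real.cosh x)) / (2 * besselK 1 ζ) := by
  simp only [avg, juttner, ← mul_div_assoc, integral_div]

theorem integral_mul_exp_eq_two_mul_integral_Ioi {f : ℝ → ℝ} (hf : ∀ x, f |x| = f x) (ζ : ℝ) :
    ∫ x, f x * Real.exp (-ζ * Real.cosh x) =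
      2 * ∫ x in Set.Ioi (0 : ℝ), f x * Real.exp (-ζ * Real.cosh x) := by
  rw [← integral_comp_abs (f := fun x => f x * Real.exp (-ζ * Real.cosh x))]
  simp only [hf, Real.cosh_abs]

theorem two_mul_besselK_one (ζ : ℝ) :
    2 * besselK 1 ζ = ∫ x, Real.cosh x * Real.exp (-ζ * Real.cosh x) := by
  rw [integral_mul_exp_eq_two_mul_integral_Ioi Real.cosh_abs, besselK]
  simp only [Nat.cast_one, one_mul]

theorem integral_mul_exp_pos {f : ℝ → ℝ} (hf : f ∈ expAlgebra) (h₀ : 0 ≤ f) {x₀ : ℝ}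
    (hx₀ : f x₀ ≠ 0) {ζ : ℝ} (hζ : 0 < ζ) :
    0 < ∫ x, f x * Real.exp (-ζ * Real.cosh x) := by
  have hf' := (differentiable_of_mem_expAlgebra hf).continuous
  have hc : Continuous fun x => f x * Real.exp (-ζ * Real.cosh x) := by fun_prop
  rw [integral_pos_iff_support_of_nonneg (fun x => mul_nonneg (h₀ x) (Real.exp_pos _).le)
    (integrable_mul_exp_of_mem_expAlgebra hf hζ)]
  exact hc.isOpen_support.measure_pos _ ⟨x₀, mul_ne_zero hx₀ (Real.exp_ne_zero _)⟩

theorem two_mul_besselK_one_pos {ζ : ℝ} (hζ : 0 < ζ) : 0 < 2 * besselK 1 ζ := by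
  rw [two_mul_besselK_one]
  exact integral_mul_exp_pos cosh_mem_expAlgebra (fun x => (Real.cosh_pos x).le) (x₀ := 0)
    (by simp) hζ

theorem juttner_pos {ζ : ℝ} (hζ : 0 < ζ) (x : ℝ) : 0 < juttner ζ x :=
  div_pos (Real.exp_pos _) (two_mul_besselK_one_pos hζ)

theorem integrable_mul_juttner {f : ℝ → ℝ} (hf : f ∈ expAlgebra) {ζ : ℝ} (hζ : 0 < ζ) :
    Integrable fun x => f x * juttner ζ x := by
  simp only [juttner, ← mul_div_assoc]
  exact (integrable_mul_exp_of_mem_expAlgebra hf hζ).div_const _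

theorem avg_add {f g : ℝ → ℝ} (hf : f ∈ expAlgebra) (hg : g ∈ expAlgebra) {ζ : ℝ} (hζ : 0 < ζ) :
    avg ζ (f + g) = avg ζ f + avg ζ g := by
  simp only [avg, Pi.add_apply, add_mul]
  exact integral_add (integrable_mul_juttner hf hζ) (integrable_mul_juttner hg hζ)

theorem avg_smul (c ζ : ℝ) (f : ℝ → ℝ) : avg ζ (c • f) = c * avg ζ f := by
  simp only [avg, Pi.smul_apply, smul_eq_mul, mul_assoc, integral_const_mul]

theorem avg_neg (ζ : ℝ) (f : ℝ → ℝ) : avg ζ (-f) = -avg ζ f := by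
  simpa using avg_smul (-1) ζ f

theorem avg_sub {f g : ℝ → ℝ} (hf : f ∈ expAlgebra) (hg : g ∈ expAlgebra) {ζ : ℝ} (hζ : 0 < ζ) :
    avg ζ (f - g) = avg ζ f - avg ζ g := by
  rw [sub_eq_add_neg, avg_add hf (expAlgebra.neg_mem hg) hζ, avg_neg, sub_eq_add_neg]

theorem avg_sum {ι : Type*} {s : Finset ι} {f : ι → ℝ → ℝ} (hf : ∀ i ∈ s, f i ∈ expAlgebra)
    {ζ : ℝ} (hζ : 0 < ζ) : avg ζ (∑ i ∈ s, f i) = ∑ i ∈ s, avg ζ (f i) := by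
  simp only [avg, Finset.sum_apply, Finset.sum_mul]
  exact integral_finsetSum _ fun i hi => integrable_mul_juttner (hf i hi) hζ

theorem avg_pos {f : ℝ → ℝ} (hf : f ∈ expAlgebra) (h₀ : 0 ≤ f) {x₀ : ℝ} (hx₀ : f x₀ ≠ 0) {ζ : ℝ}
    (hζ : 0 < ζ) : 0 < avg ζ f := by
  rw [avg_eq_div]
  exact div_pos (integral_mul_exp_pos hf h₀ hx₀ hζ) (two_mul_besselK_one_pos hζ)

theorem avg_eq_zero_of_odd {f : ℝ → ℝ} (hf : f.Odd) (ζ : ℝ) : avg ζ f = 0 := by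
  have h := integral_neg_eq_self (fun x => f x * juttner ζ x) volume
  simp only [hf _, juttner, Real.cosh_neg, neg_mul, integral_neg] at h
  simp only [avg, juttner, neg_mul]
  linarith

theorem avg_cosh {ζ : ℝ} (hζ : 0 < ζ) : avg ζ Real.cosh = 1 := by
  rw [avg_eq_div, ← two_mul_besselK_one, div_self (two_mul_besselK_one_pos hζ).ne']

theorem hasDerivAt_mul_juttner {f : ℝ → ℝ} (hf : f ∈ expAlgebra) (ζ x : ℝ) :
    HasDerivAt (fun x => f x * juttner ζ x)
      ((deriv f - ζ • (Real.sinh * f)) x * juttner ζ x) x := by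
  refine ((differentiable_of_mem_expAlgebra hf x).hasDerivAt.mul
    (((Real.hasDerivAt_cosh x).const_mul (-ζ)).exp.div_const _)).congr_deriv ?_
  simp only [juttner, Pi.sub_apply, Pi.smul_apply, Pi.mul_apply, smul_eq_mul]
  ring

theorem avg_deriv {f : ℝ → ℝ} (hf : f ∈ expAlgebra) {ζ : ℝ} (hζ : 0 < ζ) :
    avg ζ (deriv f) = ζ * avg ζ (Real.sinh * f) := by
  have hsf := expAlgebra.mul_mem sinh_mem_expAlgebra hf
  have htotal : avg ζ (deriv f - ζ • (Real.sinh * f)) = 0 :=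
    integral_eq_zero_of_hasDerivAt_of_integrable (hasDerivAt_mul_juttner hf ζ)
      (integrable_mul_juttner (expAlgebra.sub_mem (deriv_mem_expAlgebra hf)
        (expAlgebra.smul_mem hsf ζ)) hζ) (integrable_mul_juttner hf hζ)
  rw [avg_sub (deriv_mem_expAlgebra hf) (expAlgebra.smul_mem hsf ζ) hζ, avg_smul] at htotal
  linarith

theorem avg_deriv_sub_sinh_mul {f r : ℝ → ℝ} (hf : f ∈ expAlgebra) (hr : r ∈ expAlgebra) {ζ : ℝ}
    (hζ : 0 < ζ) :
    avg ζ ((deriv f - ζ • (Real.sinh * f)) * r) = -avg ζ (f * deriv r) := by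
  have hf' := deriv_mem_expAlgebra hf
  have hr' := deriv_mem_expAlgebra hr
  have hderiv : deriv (f * r) = deriv f * r + f * deriv r := funext fun x =>
    deriv_mul (differentiable_of_mem_expAlgebra hf x) (differentiable_of_mem_expAlgebra hr x)
  have hfr := avg_deriv (expAlgebra.mul_mem hf hr) hζ
  rw [hderiv, avg_add (expAlgebra.mul_mem hf' hr) (expAlgebra.mul_mem hf hr') hζ] at hfr
  rw [sub_mul, smul_mul_assoc, avg_sub (expAlgebra.mul_mem hf' hr) (expAlgebra.smul_mem
    (expAlgebra.mul_mem (expAlgebra.mul_mem sinh_mem_expAlgebra hf) hr) ζ) hζ, avg_smul, mul_assoc]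
  linarith

theorem avg_cosh_sq {ζ : ℝ} (hζ : 0 < ζ) : avg ζ (Real.cosh ^ 2) = avg ζ 1 + ζ⁻¹ := by
  have hcosh : Real.cosh ^ 2 = 1 + Real.sinh * Real.sinh := by
    ext x
    simp only [Pi.pow_apply, Pi.add_apply, Pi.one_apply, Pi.mul_apply, Real.cosh_sq]
    ring
  have hsinh := avg_deriv sinh_mem_expAlgebra hζ
  rw [Real.deriv_sinh, avg_cosh hζ] at hsinh
  rw [hcosh, avg_add expAlgebra.one_mem
    (expAlgebra.mul_mem sinh_mem_expAlgebra sinh_mem_expAlgebra) hζ,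
    eq_inv_of_mul_eq_one_right hsinh.symm]

theorem avg_cosh_pow_pos (n : ℕ) {ζ : ℝ} (hζ : 0 < ζ) : 0 < avg ζ (Real.cosh ^ n) :=
  avg_pos (expAlgebra.pow_mem cosh_mem_expAlgebra n) (fun x => (pow_pos (Real.cosh_pos x) n).le)
    (x₀ := 0) (by simp) hζ

theorem sq_avg_cosh_pow_lt (n : ℕ) {ζ : ℝ} (hζ : 0 < ζ) :
    avg ζ (Real.cosh ^ (n + 1)) ^ 2 < avg ζ (Real.cosh ^ n) * avg ζ (Real.cosh ^ (n + 2)) := by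
  have hpow := expAlgebra.pow_mem cosh_mem_expAlgebra
  have hn := avg_cosh_pow_pos n hζ
  obtain ⟨x₀, hx₀⟩ : ∃ x₀, Real.cosh x₀ ≠ avg ζ (Real.cosh ^ (n + 1)) / avg ζ (Real.cosh ^ n) := by
    by_contra! h
    exact absurd ((h 0).trans (h 1).symm) (by simpa using (Real.one_lt_cosh.mpr one_ne_zero).ne)
  set t := avg ζ (Real.cosh ^ (n + 1)) / avg ζ (Real.cosh ^ n)
  have hexpand : Real.cosh ^ n * (Real.cosh - t • 1) ^ 2 =
      Real.cosh ^ (n + 2) - (2 * t) • Real.cosh ^ (n + 1) + (t ^ 2) • Real.cosh ^ n := by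
    ext x
    simp only [Pi.mul_apply, Pi.pow_apply, Pi.sub_apply, Pi.add_apply, Pi.smul_apply, Pi.one_apply,
      smul_eq_mul]
    ring
  have hpos : 0 < avg ζ (Real.cosh ^ n * (Real.cosh - t • 1) ^ 2) :=
    avg_pos (expAlgebra.mul_mem (hpow n) (expAlgebra.pow_mem (expAlgebra.sub_mem
      cosh_mem_expAlgebra (expAlgebra.smul_mem expAlgebra.one_mem t)) 2))
      (fun x => mul_nonneg (pow_nonneg (Real.cosh_pos x).le n) (sq_nonneg _)) (x₀ := x₀)
      (mul_ne_zero (pow_ne_zero n (Real.cosh_pos x₀).ne') (pow_ne_zero 2 (by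
        simpa [sub_eq_zero] using hx₀))) hζ
  rw [hexpand, avg_add (expAlgebra.sub_mem (hpow _) (expAlgebra.smul_mem (hpow _) _))
    (expAlgebra.smul_mem (hpow _) _) hζ, avg_sub (hpow _) (expAlgebra.smul_mem (hpow _) _) hζ,
    avg_smul, avg_smul] at hpos
  have htn : t * avg ζ (Real.cosh ^ n) = avg ζ (Real.cosh ^ (n + 1)) := div_mul_cancel₀ _ hn.ne'
  nlinarith [mul_pos hpos hn]

theorem hasDerivAt_integral_mul_exp {f : ℝ → ℝ} (hf : f ∈ expAlgebra) {ζ : ℝ} (hζ : 0 < ζ) :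
    HasDerivAt (fun z => ∫ x, f x * Real.exp (-z * Real.cosh x))
      (-∫ x, (Real.cosh * f) x * Real.exp (-ζ * Real.cosh x)) ζ := by
  have hcont := (differentiable_of_mem_expAlgebra hf).continuous
  have hcf := expAlgebra.mul_mem cosh_mem_expAlgebra hf
  rw [← integral_neg]
  refine (hasDerivAt_integral_of_dominated_loc_of_deriv_le (μ := volume)
    (F' := fun z x => -((Real.cosh * f) x * Real.exp (-z * Real.cosh x)))
    (bound := fun x => ‖(Real.cosh * f) x * Real.exp (-(ζ / 2) * Real.cosh x)‖)
    (Ioi_mem_nhds (half_lt_self hζ)) (.of_forall fun z => by fun_prop)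
    (integrable_mul_exp_of_mem_expAlgebra hf hζ) (by simp only [Pi.mul_apply]; fun_prop)
    (ae_of_all _ fun x z hz => ?_) (integrable_mul_exp_of_mem_expAlgebra hcf (half_pos hζ)).norm
    (ae_of_all _ fun x z _ => ?_)).2
  · rw [norm_neg, norm_mul, norm_mul _ (Real.exp _), Real.norm_of_nonneg (Real.exp_pos _).le,
      Real.norm_of_nonneg (Real.exp_pos _).le]
    have : -z * Real.cosh x ≤ -(ζ / 2) * Real.cosh x :=
      mul_le_mul_of_nonneg_right (neg_le_neg (le_of_lt hz)) (Real.cosh_pos x).le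
    gcongr
  · refine ((((hasDerivAt_neg' z).mul_const (Real.cosh x)).exp).const_mul (f x)).congr_deriv ?_
    simp only [Pi.mul_apply]
    ring

theorem hasDerivAt_two_mul_besselK_one {ζ : ℝ} (hζ : 0 < ζ) :
    HasDerivAt (fun z => 2 * besselK 1 z) (-(2 * besselK 1 ζ * avg ζ (Real.cosh ^ 2))) ζ := by
  rw [avg_eq_div, mul_div_cancel₀ _ (two_mul_besselK_one_pos hζ).ne', sq]
  simp only [two_mul_besselK_one]
  exact hasDerivAt_integral_mul_exp cosh_mem_expAlgebra hζ

theorem hasDerivAt_juttner {ζ : ℝ} (hζ : 0 < ζ) (x : ℝ) :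
    HasDerivAt (fun z => juttner z x) ((avg ζ (Real.cosh ^ 2) - Real.cosh x) * juttner ζ x) ζ := by
  have h := (two_mul_besselK_one_pos hζ).ne'
  refine (((hasDerivAt_neg' ζ).mul_const (Real.cosh x)).exp.div
    (hasDerivAt_two_mul_besselK_one hζ) h).congr_deriv ?_
  simp only [juttner]
  field_simp
  ring

theorem hasDerivAt_avg {f : ℝ → ℝ} (hf : f ∈ expAlgebra) {ζ : ℝ} (hζ : 0 < ζ) :
    HasDerivAt (fun z => avg z f)
      (avg ζ (Real.cosh ^ 2) * avg ζ f - avg ζ (Real.cosh * f)) ζ := by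
  have h := (two_mul_besselK_one_pos hζ).ne'
  have hquot := (hasDerivAt_integral_mul_exp hf hζ).div (hasDerivAt_two_mul_besselK_one hζ) h
  simp only [avg_eq_div _ f, avg_eq_div _ (Real.cosh * f)]
  refine hquot.congr_deriv ?_
  field_simp
  ring

/-! ### Orthonormal polynomials -/

theorem cosh_image_Ioi : Real.cosh '' Set.Ioi 0 = Set.Ioi 1 := by
  ext y
  constructor
  · rintro ⟨x, hx, rfl⟩
    exact Real.one_lt_cosh.mpr (ne_of_gt hx)
  · exact fun hy => ⟨Real.arcosh y, Real.arcosh_pos hy, Real.cosh_arcosh (le_of_lt hy)⟩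

theorem polyInner_eq_avg (l : ℕ) (ζ : ℝ) (P Q : ℝ[X]) :
    polyInner l ζ P Q = avg ζ (aeval Real.cosh (P * Q) * Real.sinh ^ (2 * l)) := by
  rw [avg_eq_div, integral_mul_exp_eq_two_mul_integral_Ioi fun x => by
      simp [pow_mul, Real.sinh_sq, Real.cosh_abs, aeval_fn_apply],
    mul_div_mul_left _ _ two_ne_zero, ← integral_div, polyInner, ← cosh_image_Ioi,
    integral_image_eq_integral_abs_deriv_smul measurableSet_Ioi
      (fun x _ => (Real.hasDerivAt_cosh x).hasDerivWithinAt)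
      (Real.cosh_injOn.mono Set.Ioi_subset_Ici_self)]
  refine setIntegral_congr_fun measurableSet_Ioi fun x hx => ?_
  have hs : 0 < Real.sinh x := Real.sinh_pos_iff.mpr hx
  have hr : (Real.cosh x ^ 2 - 1) ^ ((l : ℝ) - 1 / 2) * Real.sinh x = Real.sinh x ^ (2 * l) := by
    rw [← Real.sinh_sq, ← Real.rpow_natCast (Real.sinh x) 2, ← Real.rpow_mul hs.le,
      ← Real.rpow_add_one hs.ne', ← Real.rpow_natCast]
    congr 1; push_cast; ring
  simp only [weight, smul_eq_mul, abs_of_pos hs, Pi.mul_apply, Pi.pow_apply, aeval_fn_apply,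
    coe_aeval_eq_eval, eval_mul]
  rw [← hr]; ring

section PolyInner

variable (l : ℕ) {ζ : ℝ}

theorem aeval_cosh_mul_sinh_pow_mem_expAlgebra (P : ℝ[X]) (n : ℕ) :
    aeval Real.cosh P * Real.sinh ^ n ∈ expAlgebra :=
  expAlgebra.mul_mem (aeval_mem_expAlgebra cosh_mem_expAlgebra P)
    (expAlgebra.pow_mem sinh_mem_expAlgebra n)

theorem polyInner_comm (ζ : ℝ) (P Q : ℝ[X]) : polyInner l ζ P Q = polyInner l ζ Q P := by
  simp only [polyInner, mul_comm (eval _ P)]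

theorem polyInner_smul_left (ζ c : ℝ) (P R : ℝ[X]) :
    polyInner l ζ (c • P) R = c * polyInner l ζ P R := by
  simp only [polyInner_eq_avg, smul_mul_assoc, map_smul, avg_smul]

theorem isLinearMap_polyInner (hζ : 0 < ζ) (R : ℝ[X]) :
    IsLinearMap ℝ fun P => polyInner l ζ P R where
  map_add P Q := by
    simp only [polyInner_eq_avg, add_mul, map_add]
    exact avg_add (aeval_cosh_mul_sinh_pow_mem_expAlgebra _ _)
      (aeval_cosh_mul_sinh_pow_mem_expAlgebra _ _) hζ
  map_smul c P := polyInner_smul_left l ζ c P R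

theorem polyInner_self_pos (hζ : 0 < ζ) {P : ℝ[X]} (hP : P ≠ 0) : 0 < polyInner l ζ P P := by
  obtain ⟨x, hx, hPx⟩ : ∃ x, 0 < x ∧ P.eval (Real.cosh x) ≠ 0 := by
    by_contra! hc
    refine hP (P.eq_zero_of_infinite_isRoot ((Set.Ioi_infinite (1 : ℝ)).mono ?_))
    rw [← cosh_image_Ioi]
    rintro _ ⟨x, hx, rfl⟩
    exact hc x hx
  rw [polyInner_eq_avg]
  refine avg_pos (aeval_cosh_mul_sinh_pow_mem_expAlgebra _ _) (fun x => ?_) (x₀ := x) ?_ hζ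
  · simp only [Pi.zero_apply, Pi.mul_apply, Pi.pow_apply, aeval_fn_apply, map_mul, pow_mul]
    exact mul_nonneg (mul_self_nonneg _) (pow_nonneg (sq_nonneg _) _)
  · simpa [aeval_fn_apply, hPx] using fun h : x = 0 => absurd h hx.ne'

/-- The polynomial `X ^ n` orthogonalized against the lower orthonormal polynomials, that is,
`orthoPoly l ζ n` before its normalization. -/
def preOrthoPoly (l : ℕ) (ζ : ℝ) (n : ℕ) : ℝ[X] :=
  X ^ n - ∑ k : Fin n, polyInner l ζ (X ^ n) (orthoPoly l ζ k) • orthoPoly l ζ k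

theorem orthoPoly_eq_smul (ζ : ℝ) (n : ℕ) : orthoPoly l ζ n =
    (√(polyInner l ζ (preOrthoPoly l ζ n) (preOrthoPoly l ζ n)))⁻¹ • preOrthoPoly l ζ n := by
  rw [orthoPoly]
  simp only [preOrthoPoly, smul_eq_C_mul]

theorem degree_preOrthoPoly (ζ : ℝ) (n : ℕ) : (preOrthoPoly l ζ n).degree = n := by
  induction n using Nat.strong_induction_on with
  | _ n ih =>
    suffices h : ∑ k : Fin n, polyInner l ζ (X ^ n) (orthoPoly l ζ k) • orthoPoly l ζ k
        ∈ degreeLT ℝ n by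
      rw [preOrthoPoly, degree_sub_eq_left_of_degree_lt] <;> rw [degree_X_pow]
      exact mem_degreeLT.mp h
    refine Submodule.sum_mem _ fun k _ => Submodule.smul_mem _ _ (mem_degreeLT.mpr ?_)
    rw [orthoPoly_eq_smul]
    exact (degree_smul_le _ _).trans_lt (ih k k.2 ▸ Nat.cast_lt.mpr k.2)

theorem polyInner_preOrthoPoly_self_pos (hζ : 0 < ζ) (n : ℕ) :
    0 < polyInner l ζ (preOrthoPoly l ζ n) (preOrthoPoly l ζ n) :=
  polyInner_self_pos l hζ (ne_zero_of_coe_le_degree (degree_preOrthoPoly l ζ n).ge)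

theorem degree_orthoPoly (hζ : 0 < ζ) (n : ℕ) : (orthoPoly l ζ n).degree = n := by
  rw [orthoPoly_eq_smul, degree_smul_of_smul_regular, degree_preOrthoPoly]
  exact (IsUnit.mk0 _ (inv_ne_zero
    (Real.sqrt_pos.mpr (polyInner_preOrthoPoly_self_pos l hζ n)).ne')).isSMulRegular _

theorem polyInner_orthoPoly_self (hζ : 0 < ζ) (n : ℕ) :
    polyInner l ζ (orthoPoly l ζ n) (orthoPoly l ζ n) = 1 := by
  have hpos := polyInner_preOrthoPoly_self_pos l hζ n
  rw [orthoPoly_eq_smul, polyInner_smul_left, polyInner_comm l ζ (preOrthoPoly l ζ n) (_ • _),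
    polyInner_smul_left, ← mul_assoc, ← mul_inv, Real.mul_self_sqrt hpos.le,
    inv_mul_cancel₀ hpos.ne']

theorem polyInner_orthoPoly_of_lt (hζ : 0 < ζ) {m n : ℕ} (h : m < n) :
    polyInner l ζ (orthoPoly l ζ n) (orthoPoly l ζ m) = 0 := by
  induction n using Nat.strong_induction_on generalizing m with
  | _ n ih =>
    suffices hpre : polyInner l ζ (preOrthoPoly l ζ n) (orthoPoly l ζ m) = 0 by
      rw [orthoPoly_eq_smul, polyInner_smul_left, hpre, mul_zero]
    have hlin := isLinearMap_polyInner l hζ (orthoPoly l ζ m)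
    rw [preOrthoPoly, hlin.map_sub, ← hlin.mk'_apply (∑ _, _), map_sum,
      Finset.sum_eq_single ⟨m, h⟩, hlin.mk'_apply, polyInner_smul_left,
      polyInner_orthoPoly_self l hζ, mul_one, sub_self]
    · intro k _ hk
      rw [hlin.mk'_apply, polyInner_smul_left]
      rcases (Fin.val_ne_of_ne hk).lt_or_gt with hlt | hgt
      · rw [polyInner_comm l ζ _ (orthoPoly l ζ m), ih m h hlt, mul_zero]
      · rw [ih k k.2 hgt, mul_zero]
    · simp

theorem polyInner_orthoPoly (hζ : 0 < ζ) (m n : ℕ) :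
    polyInner l ζ (orthoPoly l ζ m) (orthoPoly l ζ n) = if m = n then 1 else 0 := by
  split_ifs with h
  · rw [h, polyInner_orthoPoly_self l hζ]
  · rcases lt_or_gt_of_ne h with h | h
    · rw [polyInner_comm, polyInner_orthoPoly_of_lt l hζ h]
    · exact polyInner_orthoPoly_of_lt l hζ h

/-- The orthonormal polynomials as a sequence of polynomials of degrees `0, 1, 2, …`. -/
def orthoSequence (hζ : 0 < ζ) : Polynomial.Sequence ℝ where
  elems' := orthoPoly l ζ
  degree_eq' := degree_orthoPoly l hζ

theorem span_orthoPoly (hζ : 0 < ζ) (n : ℕ) :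
    Submodule.span ℝ (orthoPoly l ζ '' Set.Iic n) = degreeLE ℝ n :=
  (orthoSequence l hζ).span_degreeLE fun i _ => by simp

end PolyInner

/-! ### Modes and Gram matrices -/

/-- The quotient of `basisFn u θ i` by the equilibrium weight `g0 u θ`, with `ζ = θ⁻¹`, as a
function of the rapidity relative to the fluid. In this variable it does not depend on `u`. -/
def mode (ζ : ℝ) (i : ℕ) : ℝ → ℝ :=
  if i = 0 ∨ i % 2 = 1 then aeval Real.cosh (orthoPoly 0 ζ ((i + 1) / 2))
  else -(aeval Real.cosh (orthoPoly 1 ζ (i / 2 - 1)) * Real.sinh)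

theorem natDegree_orthoPoly_le (l : ℕ) (ζ : ℝ) (n : ℕ) : (orthoPoly l ζ n).natDegree ≤ n := by
  rw [orthoPoly_eq_smul]
  exact (natDegree_smul_le _ _).trans
    (natDegree_le_of_degree_le (degree_preOrthoPoly l ζ n).le)

theorem aeval_cosh_orthoPoly_mem_laurent (l : ℕ) (ζ : ℝ) (n : ℕ) :
    aeval Real.cosh (orthoPoly l ζ n) ∈ laurent n :=
  laurent_mono (natDegree_orthoPoly_le l ζ n) (aeval_cosh_mem_laurent _)

theorem mode_mem_laurent (ζ : ℝ) {M i : ℕ} (hi : i < 2 * M + 1) : mode ζ i ∈ laurent M := by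
  unfold mode
  split_ifs with h
  · exact laurent_mono (by omega) (aeval_cosh_orthoPoly_mem_laurent 0 ζ _)
  · exact Submodule.neg_mem _ (laurent_mono (by omega)
      (mul_mem_laurent (aeval_cosh_orthoPoly_mem_laurent 1 ζ _) sinh_mem_laurent))

theorem mode_mem_expAlgebra (ζ : ℝ) (i : ℕ) : mode ζ i ∈ expAlgebra :=
  laurent_le_expAlgebra i (mode_mem_laurent ζ (by omega))

theorem aeval_cosh_even (P : ℝ[X]) : (aeval Real.cosh P).Even := fun x => by
  simp [aeval_fn_apply]

theorem sinh_odd : Real.sinh.Odd := Real.sinh_neg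

theorem avg_mode_mul_mode {ζ : ℝ} (hζ : 0 < ζ) (i j : ℕ) :
    avg ζ (mode ζ i * mode ζ j) = if i = j then 1 else 0 := by
  by_cases hi : i = 0 ∨ i % 2 = 1 <;> by_cases hj : j = 0 ∨ j % 2 = 1
  · have h := polyInner_orthoPoly 0 hζ ((i + 1) / 2) ((j + 1) / 2)
    have hij : (i + 1) / 2 = (j + 1) / 2 ↔ i = j := by omega
    simpa only [polyInner_eq_avg, map_mul, mul_zero, pow_zero, mul_one, mode, if_pos hi, if_pos hj,
      hij] using h
  · rw [if_neg (by rintro rfl; exact hj hi), mode, mode, if_pos hi, if_neg hj,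
      mul_neg, avg_neg, avg_eq_zero_of_odd
        ((aeval_cosh_even _).mul_odd ((aeval_cosh_even _).mul_odd sinh_odd)), neg_zero]
  · rw [if_neg (by rintro rfl; exact hi hj), mode, mode, if_neg hi, if_pos hj,
      neg_mul, avg_neg, avg_eq_zero_of_odd
        (((aeval_cosh_even _).mul_odd sinh_odd).mul_even (aeval_cosh_even _)), neg_zero]
  · have h := polyInner_orthoPoly 1 hζ (i / 2 - 1) (j / 2 - 1)
    have hij : i / 2 - 1 = j / 2 - 1 ↔ i = j := by omega
    rw [polyInner_eq_avg] at h
    simp only [hij] at h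
    rw [← h, mode, mode, if_neg hi, if_neg hj, map_mul]
    congr 1
    ring

/-- The function whose coefficients with respect to the modes are given. -/
def modeSum {M : ℕ} (ζ : ℝ) : (Fin (2 * M + 1) → ℝ) →ₗ[ℝ] ℝ → ℝ :=
  Fintype.linearCombination ℝ fun i : Fin (2 * M + 1) => mode ζ i

/-- The matrix of the multiplication by `a` compressed to the span of the first modes. -/
def gram (M : ℕ) (ζ : ℝ) (a : ℝ → ℝ) : Matrix (Fin (2 * M + 1)) (Fin (2 * M + 1)) ℝ :=
  Matrix.of fun k i => avg ζ (a * mode ζ k * mode ζ i)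

section Modes

variable {M : ℕ} {ζ : ℝ}

theorem modeSum_mem_laurent (ζ : ℝ) (c : Fin (2 * M + 1) → ℝ) : modeSum ζ c ∈ laurent M := by
  rw [modeSum, Fintype.linearCombination_apply]
  exact Submodule.sum_mem _ fun i _ => Submodule.smul_mem _ _ (mode_mem_laurent ζ i.2)

theorem modeSum_mem_expAlgebra (ζ : ℝ) (c : Fin (2 * M + 1) → ℝ) : modeSum ζ c ∈ expAlgebra :=
  laurent_le_expAlgebra M (modeSum_mem_laurent ζ c)

theorem avg_mul_modeSum {f : ℝ → ℝ} (hf : f ∈ expAlgebra) (hζ : 0 < ζ)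
    (c : Fin (2 * M + 1) → ℝ) : avg ζ (f * modeSum ζ c) = ∑ i, c i * avg ζ (f * mode ζ i) := by
  simp only [modeSum, Fintype.linearCombination_apply, Finset.mul_sum, mul_smul_comm]
  rw [avg_sum (f := fun i => c i • (f * mode ζ i)) (fun i _ =>
    expAlgebra.smul_mem (expAlgebra.mul_mem hf (mode_mem_expAlgebra ζ i)) _) hζ]
  simp only [avg_smul]

theorem avg_mode_mul_modeSum (hζ : 0 < ζ) (c : Fin (2 * M + 1) → ℝ) (k : Fin (2 * M + 1)) :
    avg ζ (mode ζ k * modeSum ζ c) = c k := by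
  simp [avg_mul_modeSum (mode_mem_expAlgebra ζ k) hζ, avg_mode_mul_mode hζ, Fin.val_inj]

theorem modeSum_injective (hζ : 0 < ζ) : Function.Injective (modeSum (M := M) ζ) := fun c d h => by
  ext k
  rw [← avg_mode_mul_modeSum hζ c, h, avg_mode_mul_modeSum hζ]

theorem range_modeSum (hζ : 0 < ζ) : LinearMap.range (modeSum (M := M) ζ) = laurent M := by
  refine Submodule.eq_of_le_of_finrank_le ?_ ?_
  · rintro _ ⟨c, rfl⟩
    exact modeSum_mem_laurent ζ c
  · rw [LinearMap.finrank_range_of_inj (modeSum_injective hζ), Module.finrank_fin_fun]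
    exact finrank_laurent_le M

variable {a : ℝ → ℝ}

theorem gram_mulVec (hζ : 0 < ζ) (ha : a ∈ expAlgebra) (c : Fin (2 * M + 1) → ℝ)
    (k : Fin (2 * M + 1)) : (gram M ζ a *ᵥ c) k = avg ζ (a * mode ζ k * modeSum ζ c) := by
  rw [avg_mul_modeSum (expAlgebra.mul_mem ha (mode_mem_expAlgebra ζ k)) hζ]
  simp only [mulVec, dotProduct, gram, of_apply, mul_comm (c _)]

theorem dotProduct_gram_mulVec (hζ : 0 < ζ) (ha : a ∈ expAlgebra) (c d : Fin (2 * M + 1) → ℝ) :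
    d ⬝ᵥ gram M ζ a *ᵥ c = avg ζ (a * modeSum ζ c * modeSum ζ d) := by
  rw [avg_mul_modeSum (expAlgebra.mul_mem ha (modeSum_mem_expAlgebra ζ c)) hζ]
  simp only [dotProduct, gram_mulVec hζ ha, mul_right_comm a]

theorem gram_isHermitian (M : ℕ) (ζ : ℝ) (a : ℝ → ℝ) : (gram M ζ a).IsHermitian := by
  ext i j
  simp only [conjTranspose_apply, gram, of_apply, star_trivial, mul_right_comm a]

theorem gram_posDef (hζ : 0 < ζ) (ha : a ∈ expAlgebra) (hpos : ∀ x, 0 < a x) :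
    (gram M ζ a).PosDef := by
  refine .of_dotProduct_mulVec_pos (gram_isHermitian M ζ a) fun {c} hc => ?_
  obtain ⟨x, hx⟩ := Function.ne_iff.mp ((map_ne_zero_iff _ (modeSum_injective hζ)).mpr hc)
  rw [star_trivial, dotProduct_gram_mulVec hζ ha]
  refine avg_pos (expAlgebra.mul_mem (expAlgebra.mul_mem ha (modeSum_mem_expAlgebra ζ c))
    (modeSum_mem_expAlgebra ζ c)) (fun y => ?_) (mul_ne_zero (mul_ne_zero (hpos x).ne' hx) hx) hζ
  rw [mul_assoc]
  exact mul_nonneg (hpos y).le (mul_self_nonneg _)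

theorem mul_mode_mul_mode_mem_expAlgebra (ha : a ∈ expAlgebra) (k i : ℕ) :
    a * mode ζ k * mode ζ i ∈ expAlgebra :=
  expAlgebra.mul_mem (expAlgebra.mul_mem ha (mode_mem_expAlgebra ζ k)) (mode_mem_expAlgebra ζ i)

theorem gram_add {b : ℝ → ℝ} (ha : a ∈ expAlgebra) (hb : b ∈ expAlgebra) (hζ : 0 < ζ) :
    gram M ζ (a + b) = gram M ζ a + gram M ζ b := by
  ext k i
  simp only [gram, of_apply, add_mul, Matrix.add_apply]
  exact avg_add (mul_mode_mul_mode_mem_expAlgebra ha k i)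
    (mul_mode_mul_mode_mem_expAlgebra hb k i) hζ

theorem gram_smul (c : ℝ) : gram M ζ (c • a) = c • gram M ζ a := by
  ext k i
  simp only [gram, of_apply, smul_mul_assoc, avg_smul, Matrix.smul_apply, smul_eq_mul]

theorem gram_sub {b : ℝ → ℝ} (ha : a ∈ expAlgebra) (hb : b ∈ expAlgebra) (hζ : 0 < ζ) :
    gram M ζ (a - b) = gram M ζ a - gram M ζ b := by
  ext k i
  simp only [gram, of_apply, sub_mul, Matrix.sub_apply]
  exact avg_sub (mul_mode_mul_mode_mem_expAlgebra ha k i)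
    (mul_mode_mul_mode_mem_expAlgebra hb k i) hζ

theorem eq_zero_of_gram_mulVec_eq_zero (hζ : 0 < ζ) (ha : a ∈ expAlgebra) {x₀ : ℝ}
    (hsign : ∀ x ≠ x₀, 0 < a x * (Real.exp x - Real.exp x₀)) {c : Fin (2 * M + 1) → ℝ}
    (hc : gram M ζ a *ᵥ c = 0) (h₀ : modeSum ζ c x₀ = 0) : c = 0 := by
  by_contra hne
  obtain ⟨g, hg, hfac⟩ := exists_mem_laurent_eq_exp_sub_mul (modeSum_mem_laurent ζ c) h₀
  obtain ⟨d, hd⟩ : g ∈ LinearMap.range (modeSum (M := M) ζ) := (range_modeSum hζ).symm ▸ hg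
  obtain ⟨x₁, hx₁⟩ := Function.ne_iff.mp ((map_ne_zero_iff _ (modeSum_injective hζ)).mpr hne)
  have hval : ∀ x, (a * modeSum ζ c * modeSum ζ d) x =
      a x * (Real.exp x - Real.exp x₀) * g x ^ 2 := fun x => by
    simp only [Pi.mul_apply, hfac, hd]; ring
  have hpos : 0 < avg ζ (a * modeSum ζ c * modeSum ζ d) := by
    refine avg_pos (expAlgebra.mul_mem (expAlgebra.mul_mem ha (modeSum_mem_expAlgebra ζ c))
      (modeSum_mem_expAlgebra ζ d)) (fun x => ?_) (x₀ := x₁) ?_ hζ <;> rw [hval]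
    · rcases eq_or_ne x x₀ with rfl | hx
      · simp
      · exact mul_nonneg (hsign x hx).le (sq_nonneg _)
    · have hx : x₁ ≠ x₀ := by rintro rfl; exact hx₁ h₀
      have hgx : g x₁ ≠ 0 := by intro h; simp [hfac, h] at hx₁
      exact mul_ne_zero (hsign x₁ hx).ne' (pow_ne_zero 2 hgx)
  rw [← dotProduct_gram_mulVec hζ ha, hc, dotProduct_zero] at hpos
  exact hpos.false

theorem cosh_add_mem_expAlgebra (y : ℝ) : (fun x => Real.cosh (x + y)) ∈ expAlgebra := by
  have h : (fun x => Real.cosh (x + y)) =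
      Real.cosh y • Real.cosh + Real.sinh y • Real.sinh := by
    ext x
    simp only [Real.cosh_add, Pi.add_apply, Pi.smul_apply, smul_eq_mul]
    ring
  exact h ▸ expAlgebra.add_mem (expAlgebra.smul_mem cosh_mem_expAlgebra _)
    (expAlgebra.smul_mem sinh_mem_expAlgebra _)

theorem sinh_add_mem_expAlgebra (y : ℝ) : (fun x => Real.sinh (x + y)) ∈ expAlgebra := by
  have h : (fun x => Real.sinh (x + y)) =
      Real.cosh y • Real.sinh + Real.sinh y • Real.cosh := by
    ext x
    simp only [Real.sinh_add, Pi.add_apply, Pi.smul_apply, smul_eq_mul]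
    ring
  exact h ▸ expAlgebra.add_mem (expAlgebra.smul_mem sinh_mem_expAlgebra _)
    (expAlgebra.smul_mem cosh_mem_expAlgebra _)

theorem sinh_sub_mul_cosh_mul_exp_sub_pos {c : ℝ} (hc : |c| < 1) {x y : ℝ}
    (hx : x ≠ Real.artanh c - y) :
    0 < (Real.sinh (x + y) - c * Real.cosh (x + y)) *
      (Real.exp x - Real.exp (Real.artanh c - y)) := by
  have hcosh := Real.cosh_pos (Real.artanh c)
  have h : Real.sinh (x + y) - c * Real.cosh (x + y) =
      Real.sinh (x + y - Real.artanh c) / Real.cosh (Real.artanh c) := by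
    nth_rewrite 1 [← Real.tanh_artanh (abs_lt.mp hc)]
    rw [Real.tanh_eq_sinh_div_cosh, Real.sinh_sub]
    field_simp
  rw [h, div_mul_eq_mul_div]
  refine div_pos ?_ hcosh
  rcases lt_or_gt_of_ne hx with hlt | hgt
  · exact mul_pos_of_neg_of_neg (Real.sinh_neg_iff.mpr (by linarith))
      (sub_neg.mpr (Real.exp_lt_exp.mpr hlt))
  · exact mul_pos (Real.sinh_pos_iff.mpr (by linarith)) (sub_pos.mpr (Real.exp_lt_exp.mpr hgt))

theorem exists_gram_inv_mul_eq_conj_diagonal (hζ : 0 < ζ) (y : ℝ)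
    {D : Matrix (Fin (2 * M + 1)) (Fin (2 * M + 1)) ℝ} (hD : IsUnit D) :
    ∃ (P : (Matrix (Fin (2 * M + 1)) (Fin (2 * M + 1)) ℝ)ˣ) (d : Fin (2 * M + 1) → ℝ),
      Function.Injective d ∧ (∀ i, |d i| < 1) ∧
      (gram M ζ (fun x => Real.cosh (x + y)) * D)⁻¹ *
        (gram M ζ (fun x => Real.sinh (x + y)) * D) = P⁻¹ * diagonal d * P := by
  have hA := cosh_add_mem_expAlgebra y
  have hB := sinh_add_mem_expAlgebra y
  refine exists_inv_mul_eq_conj_diagonal (gram_posDef hζ hA fun x => Real.cosh_pos _)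
    (gram_isHermitian M ζ _) ?_ ?_ hD fun c hc => ?_
  · rw [← gram_add hA hB hζ]
    exact gram_posDef hζ (expAlgebra.add_mem hA hB) fun x => by
      simpa [Real.cosh_add_sinh] using Real.exp_pos (x + y)
  · rw [← gram_sub hA hB hζ]
    exact gram_posDef hζ (expAlgebra.sub_mem hA hB) fun x => by
      simpa [Real.cosh_sub_sinh] using Real.exp_pos (-(x + y))
  · refine ⟨LinearMap.proj (Real.artanh c - y) ∘ₗ modeSum ζ, fun v hv h₀ => ?_⟩
    rw [← gram_smul, ← gram_sub hB (expAlgebra.smul_mem hA c) hζ] at hv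
    exact eq_zero_of_gram_mulVec_eq_zero hζ (expAlgebra.sub_mem hB (expAlgebra.smul_mem hA c))
      (fun x hx => sinh_sub_mul_cosh_mul_exp_sub_pos hc hx) hv h₀

end Modes

/-! ### The moment system in terms of the rapidity -/

section Rapidity

variable {u : ℝ}

theorem cosh_artanh_eq_U0 (hu : |u| < 1) : Real.cosh (Real.artanh u) = U0 u := by
  rw [Real.cosh_artanh (abs_lt.mp hu), U0, one_div]

theorem sinh_artanh_eq_U1 (hu : |u| < 1) : Real.sinh (Real.artanh u) = U1 u := by
  rw [Real.sinh_artanh (abs_lt.mp hu), U1, U0, div_eq_mul_inv]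

theorem U0_pos (hu : |u| < 1) : 0 < U0 u :=
  cosh_artanh_eq_U0 hu ▸ Real.cosh_pos _

theorem p0_sinh (y : ℝ) : p0 (Real.sinh y) = Real.cosh y := by
  rw [p0, add_comm, ← Real.cosh_sq, Real.sqrt_sq (Real.cosh_pos y).le]

theorem energy_sinh (hu : |u| < 1) (y : ℝ) :
    energy u (Real.sinh y) = Real.cosh (y - Real.artanh u) := by
  rw [energy, p0_sinh, ← cosh_artanh_eq_U0 hu, ← sinh_artanh_eq_U1 hu, Real.cosh_sub]
  ring

theorem pPerp_sinh (hu : |u| < 1) (y : ℝ) :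
    pPerp u (Real.sinh y) = -(U0 u * Real.sinh (y - Real.artanh u)) := by
  rw [pPerp, energy_sinh hu, ← cosh_artanh_eq_U0 hu, ← sinh_artanh_eq_U1 hu, Real.cosh_sub,
    Real.sinh_sub]
  linear_combination Real.sinh y * Real.cosh_sq (Real.artanh u)

theorem g0_sinh (hu : |u| < 1) (θ y : ℝ) :
    g0 u θ (Real.sinh y) = juttner θ⁻¹ (y - Real.artanh u) := by
  rw [g0, energy_sinh hu, juttner, one_div_mul_eq_div, div_eq_inv_mul _ θ, neg_mul]

theorem basisFn_sinh (hu : |u| < 1) (θ : ℝ) (i : ℕ) (y : ℝ) :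
    basisFn u θ i (Real.sinh y) =
      mode θ⁻¹ i (y - Real.artanh u) * juttner θ⁻¹ (y - Real.artanh u) := by
  have hU0 := (U0_pos hu).ne'
  by_cases h : i = 0 ∨ i % 2 = 1
  · simp only [basisFn, mode, if_pos h, basisEven, energy_sinh hu, g0_sinh hu, aeval_fn_apply,
      coe_aeval_eq_eval, mul_comm]
  · simp only [basisFn, mode, if_neg h, basisOdd, energy_sinh hu, g0_sinh hu, pPerp_sinh hu,
      aeval_fn_apply, coe_aeval_eq_eval, Pi.neg_apply, Pi.mul_apply]
    field_simp

theorem inner0_eq_integral_sinh (u θ y : ℝ) (f h : ℝ → ℝ) :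
    inner0 u θ f h =
      ∫ x, 1 / g0 u θ (Real.sinh (x + y)) * f (Real.sinh (x + y)) * h (Real.sinh (x + y)) := by
  have hsubst := integral_image_eq_integral_abs_deriv_smul (s := Set.univ) MeasurableSet.univ
    (fun x _ => (Real.hasDerivAt_sinh x).hasDerivWithinAt) Real.sinh_injective.injOn
    (fun p => 1 / g0 u θ p * f p * h p / p0 p)
  rw [Set.image_univ, Real.sinh_surjective.range_eq, setIntegral_univ, setIntegral_univ] at hsubst
  rw [inner0, hsubst, integral_add_right_eq_self
    (fun x => 1 / g0 u θ (Real.sinh x) * f (Real.sinh x) * h (Real.sinh x)) y]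
  congr 1
  ext x
  have hcosh := Real.cosh_pos x
  rw [p0_sinh, abs_of_pos hcosh, smul_eq_mul]
  field_simp

theorem inner0_basisFn (hu : |u| < 1) {θ : ℝ} (hθ : 0 < θ) (f : ℝ → ℝ) (k : ℕ) :
    inner0 u θ f (basisFn u θ k) =
      ∫ x, f (Real.sinh (x + Real.artanh u)) * mode θ⁻¹ k x := by
  rw [inner0_eq_integral_sinh u θ (Real.artanh u)]
  congr 1
  ext x
  have hne := (juttner_pos (inv_pos.mpr hθ) x).ne'
  rw [basisFn_sinh hu, g0_sinh hu, add_sub_cancel_right]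
  generalize juttner θ⁻¹ x = J at hne ⊢
  field_simp

theorem proj_sinh (hu : |u| < 1) (M : ℕ) (θ : ℝ) (f : ℝ → ℝ) (x : ℝ) :
    proj M u θ f (Real.sinh (x + Real.artanh u)) =
      modeSum θ⁻¹ (fun i : Fin (2 * M + 1) => inner0 u θ f (basisFn u θ i)) x *
        juttner θ⁻¹ x := by
  simp only [proj, basisFn_sinh hu, add_sub_cancel_right, modeSum, Fintype.linearCombination_apply,
    Finset.sum_apply, Finset.sum_mul, Pi.smul_apply, smul_eq_mul, mul_assoc]

end Rapidity

section MomentMatrix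

variable {M : ℕ}

/-- The matrix whose columns are the coefficients of the functions `Π_M (∂F_M/∂W_j)`. -/
def derivMatrix (M : ℕ) (W : Fin (2 * M + 1) → ℝ) :
    Matrix (Fin (2 * M + 1)) (Fin (2 * M + 1)) ℝ :=
  Matrix.of fun k j => inner0 (velocity W) (temperature W) (distributionDeriv M W j)
    (basisFn (velocity W) (temperature W) k)

theorem momentMatrix_eq_gram_mul {W : Fin (2 * M + 1) → ℝ} (hu : |velocity W| < 1)
    (hθ : 0 < temperature W) {a : ℝ → ℝ}
    (ha : (fun x => a (Real.sinh (x + Real.artanh (velocity W)))) ∈ expAlgebra) :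
    momentMatrix M a W = gram M (temperature W)⁻¹
      (fun x => a (Real.sinh (x + Real.artanh (velocity W)))) * derivMatrix M W := by
  ext k j
  refine Eq.trans ?_ (gram_mulVec (inv_pos.mpr hθ) ha (fun i => derivMatrix M W i j) k).symm
  rw [momentMatrix, of_apply, inner0_basisFn hu hθ, avg]
  congr 1
  ext x
  simp only [proj_sinh hu, derivMatrix, of_apply, Pi.mul_apply]
  ring

theorem B0_eq_gram_cosh_mul {W : Fin (2 * M + 1) → ℝ} (hu : |velocity W| < 1)
    (hθ : 0 < temperature W) :
    B0 M W = gram M (temperature W)⁻¹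
      (fun x => Real.cosh (x + Real.artanh (velocity W))) * derivMatrix M W := by
  simpa only [B0, p0_sinh] using momentMatrix_eq_gram_mul (a := p0) hu hθ
    (by simpa only [p0_sinh] using cosh_add_mem_expAlgebra _)

theorem B1_eq_gram_sinh_mul {W : Fin (2 * M + 1) → ℝ} (hu : |velocity W| < 1)
    (hθ : 0 < temperature W) :
    B1 M W = gram M (temperature W)⁻¹
      (fun x => Real.sinh (x + Real.artanh (velocity W))) * derivMatrix M W :=
  momentMatrix_eq_gram_mul (a := fun p => p) hu hθ (sinh_add_mem_expAlgebra _)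

end MomentMatrix

/-! ### Families depending differentiably on a parameter -/

section DiffFamily

variable {A : Type*} [CommRing A] [Algebra ℝ A] {S : Subalgebra ℝ A} {s₀ : ℝ}

/-- The families of elements of `S` which are finite sums `∑ aᵢ(s) • fᵢ` with fixed `fᵢ ∈ S` and
coefficients `aᵢ` differentiable at `s₀`. Such families can be differentiated in `s` without a
topology on `A`. -/
def diffFamily (S : Subalgebra ℝ A) (s₀ : ℝ) : Subalgebra ℝ (ℝ → A) :=
  (Submodule.span ℝ
    {v | ∃ a : ℝ → ℝ, DifferentiableAt ℝ a s₀ ∧ ∃ f ∈ S, v = fun s => a s • f}).toSubalgebra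
    (Submodule.subset_span ⟨fun _ => 1, by fun_prop, 1, S.one_mem, by ext; simp⟩)
    fun v w hv hw => by
      have h := Submodule.mul_mem_mul hv hw
      rw [Submodule.span_mul_span] at h
      refine Submodule.span_mono ?_ h
      rintro _ ⟨_, ⟨a, ha, f, hf, rfl⟩, _, ⟨b, hb, g, hg, rfl⟩, rfl⟩
      exact ⟨a * b, ha.mul hb, f * g, S.mul_mem hf hg, by
        ext; simp [smul_smul, mul_comm]⟩

theorem smul_mem_diffFamily {a : ℝ → ℝ} (ha : DifferentiableAt ℝ a s₀) {f : A} (hf : f ∈ S) :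
    (fun s => a s • f) ∈ diffFamily S s₀ :=
  Submodule.subset_span ⟨a, ha, f, hf, rfl⟩

theorem const_mem_diffFamily {f : A} (hf : f ∈ S) : (fun _ => f) ∈ diffFamily S s₀ := by
  simpa only [one_smul] using
    smul_mem_diffFamily (differentiableAt_const (x := s₀) (1 : ℝ)) hf

theorem smul_fun_mem_diffFamily {a : ℝ → ℝ} (ha : DifferentiableAt ℝ a s₀) {v : ℝ → A}
    (hv : v ∈ diffFamily S s₀) : (fun s => a s • v s) ∈ diffFamily S s₀ := by
  have h := (diffFamily S s₀).mul_mem (smul_mem_diffFamily ha S.one_mem) hv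
  simpa only [Pi.mul_def, smul_mul_assoc, one_mul] using h

@[elab_as_elim]
theorem diffFamily_induction {p : ∀ v : ℝ → A, v ∈ diffFamily S s₀ → Prop}
    (smul : ∀ (a : ℝ → ℝ) (ha : DifferentiableAt ℝ a s₀) (f : A) (hf : f ∈ S),
      p (fun s => a s • f) (smul_mem_diffFamily ha hf))
    (add : ∀ v w hv hw, p v hv → p w hw → p (v + w) ((diffFamily S s₀).add_mem hv hw))
    {v : ℝ → A} (hv : v ∈ diffFamily S s₀) : p v hv := by
  refine Submodule.closure_induction ?_ add ?_ hv
  · simpa only [zero_smul, ← Pi.zero_def] using smul (fun _ => 0) (by fun_prop) 0 S.zero_mem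
  · rintro c _ ⟨a, ha, f, hf, rfl⟩
    simpa only [smul_smul, Pi.smul_def, smul_eq_mul] using smul (c • a) (ha.const_smul c) f hf

theorem apply_mem_of_mem_diffFamily {v : ℝ → A} (hv : v ∈ diffFamily S s₀) (s : ℝ) : v s ∈ S := by
  induction hv using diffFamily_induction with
  | smul _ _ _ hf => exact S.smul_mem hf _
  | add _ _ _ _ ihv ihw => exact S.add_mem ihv ihw

theorem differentiableAt_apply_of_mem_diffFamily {v : ℝ → A} (hv : v ∈ diffFamily S s₀)
    (φ : A →ₗ[ℝ] ℝ) : DifferentiableAt ℝ (fun s => φ (v s)) s₀ := by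
  induction hv using diffFamily_induction with
  | smul _ ha f _ => simpa only [map_smul] using ha.smul_const (φ f)
  | add _ _ _ _ ihv ihw => simpa only [Pi.add_apply, map_add] using ihv.fun_add ihw

theorem map_mem_diffFamily {B : Type*} [CommRing B] [Algebra ℝ B] {T : Subalgebra ℝ B}
    {φ : A →ₐ[ℝ] B} (hφ : ∀ f ∈ S, φ f ∈ T) {v : ℝ → A} (hv : v ∈ diffFamily S s₀) :
    (fun s => φ (v s)) ∈ diffFamily T s₀ := by
  induction hv using diffFamily_induction with
  | smul _ ha f hf => simpa only [map_smul] using smul_mem_diffFamily ha (hφ f hf)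
  | add _ _ _ _ ihv ihw =>
    simp only [Pi.add_apply, map_add]
    exact (diffFamily T s₀).add_mem ihv ihw

end DiffFamily

section Derivative

variable {s₀ : ℝ} {ζ : ℝ → ℝ}

theorem exists_hasDerivAt_avg {v : ℝ → ℝ → ℝ} (hv : v ∈ diffFamily expAlgebra s₀)
    (hd : DifferentiableAt ℝ ζ s₀) (hζ : 0 < ζ s₀) :
    ∃ w ∈ expAlgebra,
      (∀ x, HasDerivAt (fun s => v s x * juttner (ζ s) x) (w x * juttner (ζ s₀) x) s₀) ∧
      ∀ r ∈ expAlgebra, HasDerivAt (fun s => avg (ζ s) (v s * r)) (avg (ζ s₀) (w * r)) s₀ := by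
  induction hv using diffFamily_induction with
  | smul a ha f hf =>
    have hcf := expAlgebra.mul_mem cosh_mem_expAlgebra hf
    refine ⟨(deriv a s₀ + a s₀ * deriv ζ s₀ * avg (ζ s₀) (Real.cosh ^ 2)) • f -
        (a s₀ * deriv ζ s₀) • (Real.cosh * f),
      expAlgebra.sub_mem (expAlgebra.smul_mem hf _) (expAlgebra.smul_mem hcf _),
      fun x => ?_, fun r hr => ?_⟩
    · refine ((ha.hasDerivAt.mul_const (f x)).fun_mul
        ((hasDerivAt_juttner hζ x).comp s₀ hd.hasDerivAt)).congr_deriv ?_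
      simp only [Pi.sub_apply, Pi.smul_apply, Pi.mul_apply, smul_eq_mul, Function.comp_apply]
      ring
    · have hfr := expAlgebra.mul_mem hf hr
      have hcfr := expAlgebra.mul_mem hcf hr
      simp only [smul_mul_assoc, sub_mul, avg_smul]
      refine (ha.hasDerivAt.fun_mul
        ((hasDerivAt_avg hfr hζ).comp s₀ hd.hasDerivAt)).congr_deriv ?_
      rw [avg_sub (expAlgebra.smul_mem hfr _) (expAlgebra.smul_mem hcfr _) hζ, avg_smul, avg_smul,
        mul_assoc Real.cosh, Function.comp_apply]
      ring
  | add v w hv hw ihv ihw =>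
    obtain ⟨v', hv', hv'x, hv'r⟩ := ihv
    obtain ⟨w', hw', hw'x, hw'r⟩ := ihw
    refine ⟨v' + w', expAlgebra.add_mem hv' hw', fun x => ?_, fun r hr => ?_⟩
    · simpa only [Pi.add_apply, add_mul] using (hv'x x).fun_add (hw'x x)
    · rw [add_mul, avg_add (expAlgebra.mul_mem hv' hr) (expAlgebra.mul_mem hw' hr) hζ]
      refine ((hv'r r hr).fun_add (hw'r r hr)).congr_of_eventuallyEq ?_
      filter_upwards [hd.continuousAt.eventually (lt_mem_nhds hζ)] with s hs
      rw [Pi.add_apply, add_mul, avg_add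
        (expAlgebra.mul_mem (apply_mem_of_mem_diffFamily hv s) hr)
        (expAlgebra.mul_mem (apply_mem_of_mem_diffFamily hw s) hr) hs]

theorem aeval_cosh_mem_diffFamily {P : ℝ → ℝ[X]} (hP : P ∈ diffFamily ⊤ s₀) :
    (fun s => aeval Real.cosh (P s)) ∈ diffFamily expAlgebra s₀ :=
  map_mem_diffFamily (fun f _ => aeval_mem_expAlgebra cosh_mem_expAlgebra f) hP

theorem differentiableAt_polyInner (l : ℕ) (hd : DifferentiableAt ℝ ζ s₀) (hζ : 0 < ζ s₀)
    {P Q : ℝ → ℝ[X]} (hP : P ∈ diffFamily ⊤ s₀) (hQ : Q ∈ diffFamily ⊤ s₀) :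
    DifferentiableAt ℝ (fun s => polyInner l (ζ s) (P s) (Q s)) s₀ := by
  simp only [polyInner_eq_avg]
  obtain ⟨_, -, -, h⟩ := exists_hasDerivAt_avg
    (aeval_cosh_mem_diffFamily ((diffFamily ⊤ s₀).mul_mem hP hQ)) hd hζ
  exact (h _ (expAlgebra.pow_mem sinh_mem_expAlgebra (2 * l))).differentiableAt

theorem orthoPoly_mem_diffFamily (l : ℕ) (hd : DifferentiableAt ℝ ζ s₀) (hζ : 0 < ζ s₀) (n : ℕ) :
    (fun s => orthoPoly l (ζ s) n) ∈ diffFamily ⊤ s₀ := by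
  induction n using Nat.strong_induction_on with
  | _ n ih =>
    have hX : (fun _ => X ^ n) ∈ diffFamily (⊤ : Subalgebra ℝ ℝ[X]) s₀ :=
      const_mem_diffFamily Algebra.mem_top
    have hpre : (fun s => preOrthoPoly l (ζ s) n) ∈ diffFamily (⊤ : Subalgebra ℝ ℝ[X]) s₀ := by
      have hsum := Subalgebra.sum_mem _ (t := Finset.univ) fun (k : Fin n) _ =>
        smul_fun_mem_diffFamily (differentiableAt_polyInner l hd hζ hX (ih k k.2)) (ih k k.2)
      convert Subalgebra.sub_mem _ hX hsum using 1
      ext1 s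
      simp only [preOrthoPoly, Pi.sub_apply, Finset.sum_apply]
    have hpos := polyInner_preOrthoPoly_self_pos l hζ n
    simp only [orthoPoly_eq_smul]
    exact smul_fun_mem_diffFamily (((differentiableAt_polyInner l hd hζ hpre hpre).sqrt
      hpos.ne').fun_inv (Real.sqrt_pos.mpr hpos).ne') hpre

theorem differentiableAt_eval_orthoPoly (l : ℕ) (hd : DifferentiableAt ℝ ζ s₀) (hζ : 0 < ζ s₀)
    (n : ℕ) (x : ℝ) : DifferentiableAt ℝ (fun s => (orthoPoly l (ζ s) n).eval x) s₀ :=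
  differentiableAt_apply_of_mem_diffFamily (orthoPoly_mem_diffFamily l hd hζ n) (leval x)

theorem mode_mem_diffFamily (hd : DifferentiableAt ℝ ζ s₀) (hζ : 0 < ζ s₀) (i : ℕ) :
    (fun s => mode (ζ s) i) ∈ diffFamily expAlgebra s₀ := by
  unfold mode
  split_ifs
  · exact aeval_cosh_mem_diffFamily (orthoPoly_mem_diffFamily 0 hd hζ _)
  · exact (diffFamily expAlgebra s₀).neg_mem ((diffFamily expAlgebra s₀).mul_mem
      (aeval_cosh_mem_diffFamily (orthoPoly_mem_diffFamily 1 hd hζ _))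
      (const_mem_diffFamily sinh_mem_expAlgebra))

end Derivative

/-! ### The distribution function and its partial derivatives -/

theorem hasDerivAt_artanh {u : ℝ} (hu : |u| < 1) :
    HasDerivAt Real.artanh (1 / (1 - u ^ 2)) u := by
  obtain ⟨hneg, hpos⟩ := abs_lt.mp hu
  have hadd : 1 + u ≠ 0 := by linarith
  have hsub : 1 - u ≠ 0 := by linarith
  have hlog : HasDerivAt (fun x : ℝ => 1 / 2 * (Real.log (1 + x) - Real.log (1 - x)))
      (1 / 2 * (1 / (1 + u) - -1 / (1 - u))) u :=
    ((((hasDerivAt_id u).const_add 1).log hadd).fun_sub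
      (((hasDerivAt_id u).const_sub 1).log hsub)).const_mul _
  refine (hlog.congr_of_eventuallyEq ?_).congr_deriv ?_
  · filter_upwards [Ioo_mem_nhds hneg hpos] with x hx
    rw [Real.artanh_eq_half_log (Set.Ioo_subset_Icc_self hx), Real.log_div (by linarith [hx.1])
      (by linarith [hx.2])]
  · rw [show 1 - u ^ 2 = (1 + u) * (1 - u) by ring]
    field_simp
    ring

theorem leadingCoeff_orthoPoly_zero (l : ℕ) (ζ : ℝ) :
    (orthoPoly l ζ 0).leadingCoeff = (orthoPoly l ζ 0).eval 0 := by
  rw [leadingCoeff, Nat.le_zero.mp (natDegree_orthoPoly_le l ζ 0), coeff_zero_eq_eval_zero]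

theorem leadingCoeff_orthoPoly_ne_zero (l : ℕ) {ζ : ℝ} (hζ : 0 < ζ) (n : ℕ) :
    (orthoPoly l ζ n).leadingCoeff ≠ 0 := by
  rw [leadingCoeff_ne_zero, ← degree_ne_bot, degree_orthoPoly l hζ n]
  exact WithBot.coe_ne_bot

section Distribution

variable {M : ℕ} {W : Fin (2 * M + 1) → ℝ} {j : Fin (2 * M + 1)}

theorem comp_update (W : Fin (2 * M + 1) → ℝ) (j : Fin (2 * M + 1)) (s : ℝ) (k : ℕ) :
    comp (Function.update W j s) k = if k = j then s else comp W k := by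
  by_cases hk : k < 2 * M + 1
  · simp only [comp, dif_pos hk, Function.update_apply, Fin.ext_iff]
  · have hkj : k ≠ j := fun h => hk (h ▸ j.2)
    simp only [comp, dif_neg hk, if_neg hkj]

theorem comp_update_of_ne (W : Fin (2 * M + 1) → ℝ) {k : ℕ} (hk : k ≠ j) (s : ℝ) :
    comp (Function.update W j s) k = comp W k := by
  rw [comp_update, if_neg hk]

theorem comp_val (W : Fin (2 * M + 1) → ℝ) (j : Fin (2 * M + 1)) : comp W j = W j := by
  rw [comp, dif_pos j.2]

theorem hasDerivAt_comp_update (W : Fin (2 * M + 1) → ℝ) (j : Fin (2 * M + 1)) (k : ℕ) :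
    HasDerivAt (fun s => comp (Function.update W j s) k) (if k = j then 1 else 0) (W j) := by
  simp only [comp_update]
  split_ifs
  exacts [hasDerivAt_id _, hasDerivAt_const _ _]

theorem differentiableAt_inv_temperature_update (hθ : 0 < temperature W) :
    DifferentiableAt ℝ (fun s => (temperature (Function.update W j s))⁻¹) (W j) :=
  (hasDerivAt_comp_update W j 2).differentiableAt.fun_inv
    (by rw [Function.update_eq_self]; exact hθ.ne')

theorem differentiableAt_momentCoeff (hθ : 0 < temperature W) (i : ℕ) :
    DifferentiableAt ℝ (fun s => momentCoeff (Function.update W j s) i) (W j) := by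
  have hζ : 0 < (temperature (Function.update W j (W j)))⁻¹ := by
    rwa [Function.update_eq_self, inv_pos]
  have hP := fun l n => differentiableAt_eval_orthoPoly l
    (differentiableAt_inv_temperature_update (j := j) hθ) hζ n 0
  have hcomp := fun k => (hasDerivAt_comp_update W j k).differentiableAt
  match i with
  | 0 =>
    have hne := leadingCoeff_orthoPoly_ne_zero 0 hζ 0
    simp only [momentCoeff, leadingCoeff_orthoPoly_zero] at hne ⊢
    exact ((hcomp 0).fun_div (hP 0 0) hne).fun_sub ((hcomp 3).fun_mul (hP 0 0))
  | 1 => exact (hcomp 3).fun_neg.fun_mul (hP 0 1)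
  | 2 => exact (hcomp 4).fun_neg.fun_mul (hP 1 0)
  | 3 => exact (hcomp 3).fun_neg.fun_mul (hP 0 2)
  | 4 => exact (hcomp 4).fun_neg.fun_mul (hP 1 1)
  | i + 5 => exact hcomp (i + 5)

theorem momentCoeff_update_velocity (hj : (j : ℕ) = 1) (s : ℝ) :
    momentCoeff (Function.update W j s) = momentCoeff W := by
  have hcomp : ∀ k, k ≠ 1 → comp (Function.update W j s) k = comp W k := fun k hk =>
    comp_update_of_ne W (by rwa [hj]) s
  ext i
  match i with
  | 0 | 1 | 2 | 3 | 4 =>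
    simp only [momentCoeff, density, temperature, bulkPressure, diffusion, hcomp 0 (by decide),
      hcomp 2 (by decide), hcomp 3 (by decide), hcomp 4 (by decide)]
  | i + 5 => exact hcomp (i + 5) (by omega)

/-- The distribution function divided by the equilibrium distribution, as a function of the
rapidity relative to the mean velocity. -/
def profile (W : Fin (2 * M + 1) → ℝ) : ℝ → ℝ :=
  modeSum (temperature W)⁻¹ fun i : Fin (2 * M + 1) => momentCoeff W i

theorem profile_mem_expAlgebra (W : Fin (2 * M + 1) → ℝ) : profile W ∈ expAlgebra :=
  modeSum_mem_expAlgebra _ _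

theorem distribution_sinh (hu : |velocity W| < 1) (y : ℝ) :
    distribution M W (Real.sinh y) = profile W (y - Real.artanh (velocity W)) *
      juttner (temperature W)⁻¹ (y - Real.artanh (velocity W)) := by
  simp only [distribution, basisFn_sinh hu, profile, modeSum, Fintype.linearCombination_apply,
    Finset.sum_apply, Finset.sum_mul, Pi.smul_apply, smul_eq_mul, mul_assoc]

theorem profile_update_mem_diffFamily (hθ : 0 < temperature W) :
    (fun s => profile (Function.update W j s)) ∈ diffFamily expAlgebra (W j) := by
  have hζ : 0 < (temperature (Function.update W j (W j)))⁻¹ := by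
    rwa [Function.update_eq_self, inv_pos]
  have hsum := Subalgebra.sum_mem _ (t := Finset.univ) fun (i : Fin (2 * M + 1)) _ =>
    smul_fun_mem_diffFamily (differentiableAt_momentCoeff (j := j) hθ i)
      (mode_mem_diffFamily (differentiableAt_inv_temperature_update (j := j) hθ) hζ i)
  convert hsum using 1
  ext1 s
  simp only [profile, modeSum, Fintype.linearCombination_apply, Finset.sum_apply]

/-- The moment of the distribution function with respect to the function `r` of the relative
rapidity. -/
def moment (W : Fin (2 * M + 1) → ℝ) (r : ℝ → ℝ) : ℝ :=
  avg (temperature W)⁻¹ (profile W * r)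

/-- The `j`-th partial derivative of the distribution function divided by the equilibrium
distribution, as a function of the rapidity relative to the mean velocity. -/
def derivProfile (W : Fin (2 * M + 1) → ℝ) (j : Fin (2 * M + 1)) (x : ℝ) : ℝ :=
  distributionDeriv M W j (Real.sinh (x + Real.artanh (velocity W))) / juttner (temperature W)⁻¹ x

/-- The moment of the `j`-th partial derivative of the distribution function with respect to the
function `r` of the relative rapidity. -/
def derivMoment (W : Fin (2 * M + 1) → ℝ) (j : Fin (2 * M + 1)) (r : ℝ → ℝ) : ℝ :=
  avg (temperature W)⁻¹ (derivProfile W j * r)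

theorem derivProfile_mul_juttner (hθ : 0 < temperature W) (j : Fin (2 * M + 1)) (x : ℝ) :
    derivProfile W j x * juttner (temperature W)⁻¹ x =
      distributionDeriv M W j (Real.sinh (x + Real.artanh (velocity W))) :=
  div_mul_cancel₀ _ (juttner_pos (inv_pos.mpr hθ) x).ne'

theorem derivProfile_eq_of_hasDerivAt (hθ : 0 < temperature W) {w : ℝ → ℝ}
    (hw : ∀ x, HasDerivAt
      (fun s => distribution M (Function.update W j s) (Real.sinh (x + Real.artanh (velocity W))))
      (w x * juttner (temperature W)⁻¹ x) (W j)) :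
    derivProfile W j = w := by
  ext x
  rw [derivProfile, distributionDeriv, (hw x).deriv,
    mul_div_cancel_right₀ _ (juttner_pos (inv_pos.mpr hθ) x).ne']

theorem derivProfile_of_ne_velocity (hu : |velocity W| < 1) (hθ : 0 < temperature W)
    (hj : (j : ℕ) ≠ 1) :
    derivProfile W j ∈ expAlgebra ∧ ∀ r ∈ expAlgebra,
      HasDerivAt (fun s => moment (Function.update W j s) r) (derivMoment W j r) (W j) := by
  have hvel : ∀ s, velocity (Function.update W j s) = velocity W := comp_update_of_ne W hj.symm
  have hζ : 0 < (temperature (Function.update W j (W j)))⁻¹ := by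
    rwa [Function.update_eq_self, inv_pos]
  obtain ⟨w, hw, hwx, hwr⟩ := exists_hasDerivAt_avg (profile_update_mem_diffFamily (j := j) hθ)
    (differentiableAt_inv_temperature_update hθ) hζ
  rw [Function.update_eq_self] at hwx hwr
  have hderiv : derivProfile W j = w := derivProfile_eq_of_hasDerivAt hθ fun x => by
    refine (hwx x).congr_of_eventuallyEq (.of_forall fun s => ?_)
    dsimp only
    rw [distribution_sinh (by rwa [hvel]), hvel, add_sub_cancel_right]
  exact ⟨hderiv ▸ hw, fun r hr => by simpa only [moment, derivMoment, hderiv] using hwr r hr⟩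

/-- A change of velocity translates the distribution function in the rapidity. -/
theorem derivProfile_velocity (hu : |velocity W| < 1) (hθ : 0 < temperature W)
    (hj : (j : ℕ) = 1) :
    derivProfile W j = -(1 / (1 - velocity W ^ 2)) •
      (deriv (profile W) - (temperature W)⁻¹ • (Real.sinh * profile W)) := by
  have hWj : W j = velocity W := by rw [velocity, ← hj, comp_val]
  have hvel : ∀ s, velocity (Function.update W j s) = s := fun s => by
    rw [velocity, comp_update, if_pos hj.symm]
  have htemp : ∀ s, temperature (Function.update W j s) = temperature W :=
    comp_update_of_ne W (by omega)
  refine derivProfile_eq_of_hasDerivAt hθ fun x => ?_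
  have hshift : HasDerivAt (fun s => x + Real.artanh (velocity W) - Real.artanh s)
      (-(1 / (1 - velocity W ^ 2))) (velocity W) := (hasDerivAt_artanh hu).const_sub _
  have hprofile := (hasDerivAt_mul_juttner (profile_mem_expAlgebra W) (temperature W)⁻¹
    (x + Real.artanh (velocity W) - Real.artanh (velocity W))).comp (velocity W) hshift
  rw [add_sub_cancel_right] at hprofile
  rw [hWj]
  refine (hprofile.congr_of_eventuallyEq ?_).congr_deriv (by
    simp only [Pi.smul_apply, smul_eq_mul]; ring)
  filter_upwards [Ioo_mem_nhds (abs_lt.mp hu).1 (abs_lt.mp hu).2] with s hs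
  rw [distribution_sinh (by rw [hvel]; exact abs_lt.mpr hs), hvel, htemp, profile,
    momentCoeff_update_velocity hj, htemp]
  rfl

theorem derivMoment_velocity (hu : |velocity W| < 1) (hθ : 0 < temperature W)
    (hj : (j : ℕ) = 1) {r : ℝ → ℝ} (hr : r ∈ expAlgebra) :
    derivMoment W j r = 1 / (1 - velocity W ^ 2) * moment W (deriv r) := by
  rw [derivMoment, derivProfile_velocity hu hθ hj, smul_mul_assoc, avg_smul,
    avg_deriv_sub_sinh_mul (profile_mem_expAlgebra W) hr (inv_pos.mpr hθ), neg_mul_neg, moment]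

theorem derivProfile_mem_expAlgebra (hu : |velocity W| < 1) (hθ : 0 < temperature W)
    (j : Fin (2 * M + 1)) : derivProfile W j ∈ expAlgebra := by
  by_cases hj : (j : ℕ) = 1
  · have hf := profile_mem_expAlgebra W
    rw [derivProfile_velocity hu hθ hj]
    exact expAlgebra.smul_mem (expAlgebra.sub_mem (deriv_mem_expAlgebra hf)
      (expAlgebra.smul_mem (expAlgebra.mul_mem sinh_mem_expAlgebra hf) _)) _
  · exact (derivProfile_of_ne_velocity hu hθ hj).1

theorem derivMatrix_apply (hu : |velocity W| < 1) (hθ : 0 < temperature W)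
    (k j : Fin (2 * M + 1)) :
    derivMatrix M W k j = derivMoment W j (mode (temperature W)⁻¹ k) := by
  rw [derivMatrix, of_apply, inner0_basisFn hu hθ, derivMoment, avg]
  congr 1
  ext x
  rw [← derivProfile_mul_juttner hθ, Pi.mul_apply]
  ring

theorem derivMoment_dotProduct_eq_zero (hu : |velocity W| < 1) (hθ : 0 < temperature W)
    {c : Fin (2 * M + 1) → ℝ} (hc : derivMatrix M W *ᵥ c = 0) {r : ℝ → ℝ} (hr : r ∈ laurent M) :
    (fun j => derivMoment W j r) ⬝ᵥ c = 0 := by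
  rw [← range_modeSum (inv_pos.mpr hθ)] at hr
  obtain ⟨d, rfl⟩ := hr
  have hexpand : (fun j => derivMoment W j (modeSum (temperature W)⁻¹ d)) =
      d ᵥ* derivMatrix M W := by
    ext j
    rw [derivMoment, avg_mul_modeSum (derivProfile_mem_expAlgebra hu hθ j) (inv_pos.mpr hθ)]
    simp only [vecMul, dotProduct, derivMatrix_apply hu hθ, derivMoment]
  rw [hexpand, ← dotProduct_mulVec, hc, dotProduct_zero]

end Distribution

/-! ### Moments -/

theorem avg_aeval_cosh_orthoPoly {ζ : ℝ} (hζ : 0 < ζ) (k : ℕ) :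
    avg ζ (aeval Real.cosh (orthoPoly 0 ζ k)) =
      if k = 0 then 1 / (orthoPoly 0 ζ 0).leadingCoeff else 0 := by
  have hlc := leadingCoeff_orthoPoly_ne_zero 0 hζ 0
  have hC : orthoPoly 0 ζ 0 = (orthoPoly 0 ζ 0).leadingCoeff • 1 := by
    rw [smul_eq_C_mul, mul_one, leadingCoeff_orthoPoly_zero, ← coeff_zero_eq_eval_zero]
    exact eq_C_of_natDegree_le_zero (natDegree_orthoPoly_le 0 ζ 0)
  have h := polyInner_orthoPoly 0 hζ 0 k
  rw [hC, polyInner_smul_left, polyInner_eq_avg, one_mul, mul_zero, pow_zero, mul_one] at h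
  rw [← mul_right_inj' hlc, h]
  split_ifs with h₀ h₁ h₁
  exacts [(mul_one_div_cancel hlc).symm, absurd h₀.symm h₁, absurd h₁.symm h₀, (mul_zero _).symm]

theorem isLinearMap_avg_mul {f : ℝ → ℝ} (hf : f ∈ expAlgebra) {ζ : ℝ} (hζ : 0 < ζ)
    {V : Type*} [AddCommGroup V] [Module ℝ V] {φ : V →ₗ[ℝ] ℝ → ℝ} (hφ : ∀ v, φ v ∈ expAlgebra) :
    IsLinearMap ℝ fun v => avg ζ (f * φ v) where
  map_add v w := by
    rw [map_add, mul_add, avg_add (expAlgebra.mul_mem hf (hφ v)) (expAlgebra.mul_mem hf (hφ w)) hζ]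
  map_smul c v := by rw [map_smul, mul_smul_comm, avg_smul, smul_eq_mul]

section Moments

variable {M : ℕ} {W : Fin (2 * M + 1) → ℝ}

theorem moment_mode (hθ : 0 < temperature W) {k : ℕ} (hk : k < 2 * M + 1) :
    moment W (mode (temperature W)⁻¹ k) = momentCoeff W k := by
  rw [moment, profile, mul_comm, avg_mode_mul_modeSum (inv_pos.mpr hθ) _ ⟨k, hk⟩]

theorem moment_aeval_cosh_orthoPoly (hθ : 0 < temperature W) {k : ℕ} (hk : k ≤ 2) (hkM : k ≤ M) :
    moment W (aeval Real.cosh (orthoPoly 0 (temperature W)⁻¹ k)) =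
      density W * avg (temperature W)⁻¹ (aeval Real.cosh (orthoPoly 0 (temperature W)⁻¹ k)) -
        bulkPressure W * (orthoPoly 0 (temperature W)⁻¹ k).eval 0 := by
  rw [avg_aeval_cosh_orthoPoly (inv_pos.mpr hθ)]
  interval_cases k
  · rw [if_pos rfl, mul_one_div]
    exact moment_mode (k := 0) hθ (by omega)
  · rw [if_neg one_ne_zero, mul_zero, zero_sub, ← neg_mul]
    exact moment_mode (k := 1) hθ (by omega)
  · rw [if_neg two_ne_zero, mul_zero, zero_sub, ← neg_mul]
    exact moment_mode (k := 3) hθ (by omega)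

theorem moment_aeval_cosh_orthoPoly_mul_sinh (hθ : 0 < temperature W) {k : ℕ} (hk : k ≤ 1)
    (hkM : k + 1 ≤ M) :
    moment W (aeval Real.cosh (orthoPoly 1 (temperature W)⁻¹ k) * Real.sinh) =
      diffusion W * (orthoPoly 1 (temperature W)⁻¹ k).eval 0 := by
  rw [← neg_inj, ← neg_mul, moment, ← avg_neg, ← mul_neg]
  interval_cases k
  · exact moment_mode (k := 2) hθ (by omega)
  · exact moment_mode (k := 4) hθ (by omega)

theorem moment_aeval_cosh (hθ : 0 < temperature W) {P : ℝ[X]} (hP : P.natDegree ≤ 2)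
    (hPM : P.natDegree ≤ M) :
    moment W (aeval Real.cosh P) =
      density W * avg (temperature W)⁻¹ (aeval Real.cosh P) - bulkPressure W * P.eval 0 := by
  have hζ := inv_pos.mpr hθ
  have hcosh : ∀ Q : ℝ[X], (aeval Real.cosh).toLinearMap Q ∈ expAlgebra :=
    aeval_mem_expAlgebra cosh_mem_expAlgebra
  have hmoment := isLinearMap_avg_mul (profile_mem_expAlgebra W) hζ hcosh
  have havg := isLinearMap_avg_mul expAlgebra.one_mem hζ hcosh
  have heq := LinearMap.eqOn_span' (f := hmoment.mk')
    (g := density W • havg.mk' - bulkPressure W • leval 0)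
    (s := orthoPoly 0 (temperature W)⁻¹ '' Set.Iic P.natDegree) (by
      rintro _ ⟨k, hk, rfl⟩
      simpa [moment] using
        moment_aeval_cosh_orthoPoly hθ (hk.trans hP) (hk.trans hPM))
  rw [span_orthoPoly 0 hζ] at heq
  simpa [moment] using heq (mem_degreeLE.mpr degree_le_natDegree)

theorem moment_aeval_cosh_mul_sinh (hθ : 0 < temperature W) {P : ℝ[X]} (hP : P.natDegree ≤ 1)
    (hPM : P.natDegree + 1 ≤ M) :
    moment W (aeval Real.cosh P * Real.sinh) = diffusion W * P.eval 0 := by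
  have hζ := inv_pos.mpr hθ
  let φ : ℝ[X] →ₗ[ℝ] ℝ → ℝ := LinearMap.mulRight ℝ Real.sinh ∘ₗ (aeval Real.cosh).toLinearMap
  have hφ : ∀ Q, φ Q ∈ expAlgebra := fun Q =>
    expAlgebra.mul_mem (aeval_mem_expAlgebra cosh_mem_expAlgebra Q) sinh_mem_expAlgebra
  have hmoment := isLinearMap_avg_mul (profile_mem_expAlgebra W) hζ hφ
  have heq := LinearMap.eqOn_span' (f := hmoment.mk') (g := diffusion W • leval 0)
    (s := orthoPoly 1 (temperature W)⁻¹ '' Set.Iic P.natDegree) (by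
      rintro _ ⟨k, hk, rfl⟩
      exact moment_aeval_cosh_orthoPoly_mul_sinh hθ (hk.trans hP)
        ((Nat.succ_le_succ hk).trans hPM))
  rw [span_orthoPoly 1 hζ] at heq
  exact heq (mem_degreeLE.mpr degree_le_natDegree)

theorem moment_cosh_pow (hθ : 0 < temperature W) {n : ℕ} (hn : n ≤ 2) (hnM : n ≤ M) :
    moment W (Real.cosh ^ n) =
      density W * avg (temperature W)⁻¹ (Real.cosh ^ n) - bulkPressure W * 0 ^ n := by
  simpa using moment_aeval_cosh (P := X ^ n) hθ (by simpa using hn) (by simpa using hnM)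

theorem moment_cosh (hθ : 0 < temperature W) (hM : 1 ≤ M) : moment W Real.cosh = density W := by
  simpa [avg_cosh (inv_pos.mpr hθ)] using moment_cosh_pow hθ one_le_two hM

theorem moment_cosh_pow_mul_sinh (hθ : 0 < temperature W) {n : ℕ} (hn : n ≤ 1) (hnM : n + 1 ≤ M) :
    moment W (Real.cosh ^ n * Real.sinh) = diffusion W * 0 ^ n := by
  simpa using moment_aeval_cosh_mul_sinh (P := X ^ n) hθ (by simpa using hn) (by simpa using hnM)

variable {j : Fin (2 * M + 1)}

theorem derivMoment_eq_of_hasDerivAt (hu : |velocity W| < 1) (hθ : 0 < temperature W)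
    (hj : (j : ℕ) ≠ 1) {r : ℝ → ℝ} (hr : r ∈ expAlgebra) {g : ℝ → ℝ} {d : ℝ}
    (hg : HasDerivAt g d (W j))
    (hmoment : ∀ s, 0 < temperature (Function.update W j s) →
      moment (Function.update W j s) r = g s) :
    derivMoment W j r = d := by
  refine ((derivProfile_of_ne_velocity hu hθ hj).2 r hr).unique (hg.congr_of_eventuallyEq ?_)
  have htemp := (hasDerivAt_comp_update W j 2).continuousAt
  have hpos : 0 < comp (Function.update W j (W j)) 2 := by rwa [Function.update_eq_self]
  filter_upwards [htemp.eventually (lt_mem_nhds hpos)] with s hs using hmoment s hs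

theorem derivMoment_cosh (hu : |velocity W| < 1) (hθ : 0 < temperature W) (hM : 1 ≤ M)
    (hj : (j : ℕ) ≠ 1) : derivMoment W j Real.cosh = if 0 = (j : ℕ) then 1 else 0 :=
  derivMoment_eq_of_hasDerivAt hu hθ hj cosh_mem_expAlgebra (hasDerivAt_comp_update W j 0)
    fun _ hs => moment_cosh hs hM

theorem derivMoment_cosh_pow (hu : |velocity W| < 1) (hθ : 0 < temperature W) {n : ℕ} (hn : n ≤ 2)
    (hnM : n ≤ M) (hj : 3 ≤ (j : ℕ)) :
    derivMoment W j (Real.cosh ^ n) = -((if 3 = (j : ℕ) then 1 else 0) * 0 ^ n) := by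
  refine derivMoment_eq_of_hasDerivAt hu hθ (by omega)
    (expAlgebra.pow_mem cosh_mem_expAlgebra n)
    (((hasDerivAt_comp_update W j 3).mul_const (0 ^ n)).const_sub
      (density W * avg (temperature W)⁻¹ (Real.cosh ^ n))) fun s hs => ?_
  rw [moment_cosh_pow hs hn hnM, density, temperature, comp_update_of_ne W (by omega),
    comp_update_of_ne W (by omega), ← density, ← temperature, bulkPressure]

theorem derivMoment_cosh_pow_mul_sinh (hu : |velocity W| < 1) (hθ : 0 < temperature W) {n : ℕ}
    (hn : n ≤ 1) (hnM : n + 1 ≤ M) (hj : (j : ℕ) ≠ 1) :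
    derivMoment W j (Real.cosh ^ n * Real.sinh) = (if 4 = (j : ℕ) then 1 else 0) * 0 ^ n :=
  derivMoment_eq_of_hasDerivAt hu hθ hj
    (expAlgebra.mul_mem (expAlgebra.pow_mem cosh_mem_expAlgebra n) sinh_mem_expAlgebra)
    ((hasDerivAt_comp_update W j 4).mul_const (0 ^ n))
    fun _ hs => moment_cosh_pow_mul_sinh hs hn hnM

theorem momentCoeff_of_five_le (W : Fin (2 * M + 1) → ℝ) {k : ℕ} (hk : 5 ≤ k) :
    momentCoeff W k = comp W k := by
  obtain ⟨i, rfl⟩ := Nat.exists_eq_add_of_le' hk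
  rw [momentCoeff]

theorem derivMoment_mode (hu : |velocity W| < 1) (hθ : 0 < temperature W) {k : Fin (2 * M + 1)}
    (hj : 3 ≤ (j : ℕ)) (hk : 5 ≤ (k : ℕ)) :
    derivMoment W j (mode (temperature W)⁻¹ k) = if (k : ℕ) = j then 1 else 0 := by
  have htemp : ∀ s, temperature (Function.update W j s) = temperature W :=
    comp_update_of_ne W (by omega)
  refine derivMoment_eq_of_hasDerivAt hu hθ (by omega) (mode_mem_expAlgebra _ k)
    (hasDerivAt_comp_update W j k) fun s hs => ?_
  rw [← htemp s, moment_mode hs k.2, momentCoeff_of_five_le _ hk]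

theorem derivMoment_temperature (hu : |velocity W| < 1) (hθ : 0 < temperature W) {n : ℕ}
    (hn : n ≤ 2) (hnM : n ≤ M) (hj : (j : ℕ) = 2) :
    derivMoment W j (Real.cosh ^ n) = density W * ((avg (temperature W)⁻¹ (Real.cosh ^ (n + 1)) -
      avg (temperature W)⁻¹ (Real.cosh ^ 2) * avg (temperature W)⁻¹ (Real.cosh ^ n)) /
        temperature W ^ 2) := by
  have hpow := expAlgebra.pow_mem cosh_mem_expAlgebra n
  have hWj : W j = temperature W := by rw [temperature, ← hj, comp_val]
  have havg := (hasDerivAt_avg hpow (inv_pos.mpr hθ)).comp (temperature W) (hasDerivAt_inv hθ.ne')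
  refine derivMoment_eq_of_hasDerivAt hu hθ (by omega) hpow (g := fun s =>
    density W * avg s⁻¹ (Real.cosh ^ n) - bulkPressure W * 0 ^ n) ?_ fun s hs => ?_
  · rw [hWj]
    refine ((havg.const_mul _).sub_const _).congr_deriv ?_
    rw [pow_succ' _ n]
    ring
  · rw [moment_cosh_pow hs hn hnM, density, bulkPressure, comp_update_of_ne W (by omega),
      comp_update_of_ne W (by omega), temperature, comp_update, if_pos hj.symm, density,
      bulkPressure]

theorem derivMoment_temperature_ne_zero (hρ : 0 < density W) (hu : |velocity W| < 1)
    (hθ : 0 < temperature W) {n : ℕ} (hn : n = 0 ∨ n = 2) (hnM : n ≤ M) (hj : (j : ℕ) = 2) :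
    derivMoment W j (Real.cosh ^ n) ≠ 0 := by
  have hζ := inv_pos.mpr hθ
  rw [derivMoment_temperature hu hθ (by omega) hnM hj]
  refine mul_ne_zero hρ.ne' (div_ne_zero ?_ (pow_ne_zero 2 hθ.ne'))
  rcases hn with rfl | rfl
  · have h := sq_avg_cosh_pow_lt 0 hζ
    simp only [zero_add, pow_one, avg_cosh hζ] at h ⊢
    linarith
  · have h := sq_avg_cosh_pow_lt 1 hζ
    simp only [Nat.reduceAdd, pow_one, avg_cosh hζ] at h ⊢
    linarith

theorem deriv_cosh_mul_sinh :
    deriv (Real.cosh * Real.sinh) = aeval Real.cosh (2 * X ^ 2 - 1 : ℝ[X]) := by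
  ext x
  rw [((Real.hasDerivAt_cosh x).mul (Real.hasDerivAt_sinh x)).deriv, aeval_fn_apply]
  simp only [aeval_sub, coe_aeval_eq_eval, eval_mul, eval_ofNat, eval_pow, eval_X, eval_one]
  linear_combination -Real.cosh_sq x

theorem moment_deriv_cosh_mul_sinh (hθ : 0 < temperature W) (hM : 2 ≤ M) :
    moment W (deriv (Real.cosh * Real.sinh)) =
      density W * (avg (temperature W)⁻¹ 1 + 2 * temperature W) + bulkPressure W := by
  have hζ := inv_pos.mpr hθ
  have hpow := expAlgebra.pow_mem cosh_mem_expAlgebra 2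
  have hdeg : (2 * X ^ 2 - 1 : ℝ[X]).natDegree ≤ 2 := by compute_degree
  have havg : avg (temperature W)⁻¹ (aeval Real.cosh (2 * X ^ 2 - 1 : ℝ[X])) =
      avg (temperature W)⁻¹ 1 + 2 * temperature W := by
    have hsq := avg_cosh_sq hζ
    have haeval : aeval Real.cosh (2 * X ^ 2 - 1 : ℝ[X]) = (2 : ℝ) • Real.cosh ^ 2 - 1 := by
      ext x
      simp
    rw [haeval, avg_sub (expAlgebra.smul_mem hpow 2) expAlgebra.one_mem hζ, avg_smul, hsq, inv_inv]
    ring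
  rw [deriv_cosh_mul_sinh, moment_aeval_cosh hθ hdeg (hdeg.trans hM), havg]
  simp

theorem moment_deriv_cosh_pow_mul_sinh_pos (hM : 1 ≤ M) (hW : Admissible W) :
    0 < moment W (deriv (Real.cosh ^ (min M 2 - 1) * Real.sinh)) := by
  obtain ⟨hρ, -, hθ, hbulk⟩ := hW
  obtain rfl | hM2 := hM.eq_or_lt
  · simpa [moment_cosh hθ le_rfl] using hρ
  · have hone := avg_cosh_pow_pos 0 (inv_pos.mpr hθ)
    rw [show min M 2 - 1 = 1 by omega, pow_one, moment_deriv_cosh_mul_sinh hθ hM2]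
    rw [pow_zero] at hone
    nlinarith [mul_pos hρ hone, mul_pos hρ hθ]

theorem derivMoment_velocity_ne_zero (hM : 1 ≤ M) (hW : Admissible W) (hj : (j : ℕ) = 1) :
    derivMoment W j (Real.cosh ^ (min M 2 - 1) * Real.sinh) ≠ 0 := by
  rw [derivMoment_velocity hW.2.1 hW.2.2.1 hj
    (expAlgebra.mul_mem (expAlgebra.pow_mem cosh_mem_expAlgebra _) sinh_mem_expAlgebra)]
  have hu : velocity W ^ 2 < 1 := (sq_lt_one_iff_abs_lt_one _).mpr hW.2.1
  exact mul_ne_zero (one_div_ne_zero (sub_pos.mpr hu).ne')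
    (moment_deriv_cosh_pow_mul_sinh_pos hM hW).ne'

end Moments

/-! ### Invertibility -/

theorem eq_zero_of_mulVec_eq_zero_of_blockTriangular {ι R : Type*} [Fintype ι]
    [NonUnitalNonAssocSemiring R] [NoZeroDivisors R] {T : Matrix ι ι R} {rank : ι → ℕ}
    (hrank : Function.Injective rank) (hT : T.BlockTriangular (OrderDual.toDual ∘ rank))
    (hdiag : ∀ k, T k k ≠ 0) {c : ι → R} (hc : T *ᵥ c = 0) : c = 0 := by
  funext k
  induction k using (measure rank).wf.induction with
  | h k ih =>
    have hsum : ∑ j, T k j * c j = 0 := congrFun hc k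
    have hzero : ∀ j ∈ Finset.univ, j ≠ k → T k j * c j = 0 := fun j _ hjk => by
      rcases lt_or_gt_of_ne (hrank.ne hjk) with hlt | hlt
      · rw [ih j hlt, Pi.zero_apply, mul_zero]
      · rw [hT hlt, zero_mul]
    rw [Finset.sum_eq_single_of_mem k (Finset.mem_univ k) hzero] at hsum
    exact (mul_eq_zero.mp hsum).resolve_left (hdiag k)

section Invertibility

variable {M : ℕ} {W : Fin (2 * M + 1) → ℝ}

/-- Functions of the relative rapidity whose moments determine the state one variable at a time, in
the order velocity, density, temperature, …: to first order the moment with respect to `testFn W k`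
depends on the `k`-th variable and on no later one. The exponents drop to `0` for `M = 1`, where
the higher powers of `cosh` do not belong to `laurent M`. -/
def testFn (W : Fin (2 * M + 1) → ℝ) : ℕ → ℝ → ℝ
  | 0 => Real.cosh
  | 1 => Real.cosh ^ (min M 2 - 1) * Real.sinh
  | 2 => Real.cosh ^ (2 * (min M 2 - 1))
  | 3 => 1
  | 4 => Real.sinh
  | k + 5 => mode (temperature W)⁻¹ (k + 5)

theorem testFn_mem_laurent (hM : 1 ≤ M) (W : Fin (2 * M + 1) → ℝ) (k : Fin (2 * M + 1)) :
    testFn W k ∈ laurent M := by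
  have hpow : ∀ {n}, n ≤ M → Real.cosh ^ n ∈ laurent M := fun hn =>
    laurent_mono hn (cosh_pow_mem_laurent _)
  have hsinh : ∀ {n}, n + 1 ≤ M → Real.cosh ^ n * Real.sinh ∈ laurent M := fun hn =>
    laurent_mono hn (mul_mem_laurent (cosh_pow_mem_laurent _) sinh_mem_laurent)
  obtain ⟨k, hk⟩ := k
  match k with
  | 0 => exact laurent_mono hM cosh_mem_laurent
  | 1 => exact hsinh (by omega)
  | 2 => exact hpow (by omega)
  | 3 => exact one_mem_laurent M
  | 4 => exact laurent_mono hM sinh_mem_laurent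
  | k + 5 => exact mode_mem_laurent _ hk

theorem derivMoment_testFn_eq_zero (hM : 1 ≤ M) (hW : Admissible W) {k j : Fin (2 * M + 1)}
    (hkj : Equiv.swap 0 1 (k : ℕ) < Equiv.swap 0 1 (j : ℕ)) : derivMoment W j (testFn W k) = 0 := by
  obtain ⟨-, hu, hθ, -⟩ := hW
  have hj := j.2
  obtain ⟨k, hk⟩ := k
  simp only [Equiv.swap_apply_def] at hkj
  match k with
  | 0 => rw [testFn, derivMoment_cosh hu hθ hM (by grind), if_neg (by grind)]
  | 1 =>
    rw [testFn, derivMoment_cosh_pow_mul_sinh hu hθ (by omega) (by omega) (by grind)]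
    obtain h | h : 4 ≠ (j : ℕ) ∨ min M 2 - 1 ≠ 0 := by omega
    · rw [if_neg h, zero_mul]
    · rw [zero_pow h, mul_zero]
  | 2 =>
    rw [testFn, derivMoment_cosh_pow hu hθ (by omega) (by omega) (by grind),
      zero_pow (by grind), mul_zero, neg_zero]
  | 3 =>
    rw [testFn, ← pow_zero Real.cosh, derivMoment_cosh_pow hu hθ (by omega) (by omega) (by grind),
      if_neg (by grind), zero_mul, neg_zero]
  | 4 =>
    rw [testFn, ← one_mul Real.sinh, ← pow_zero Real.cosh,
      derivMoment_cosh_pow_mul_sinh hu hθ (by omega) (by omega) (by grind), if_neg (by grind),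
      zero_mul]
  | k + 5 =>
    rw [testFn, derivMoment_mode (k := ⟨k + 5, hk⟩) hu hθ (by grind) (by simp), if_neg (by grind)]

theorem derivMoment_testFn_self_ne_zero (hM : 1 ≤ M) (hW : Admissible W) (k : Fin (2 * M + 1)) :
    derivMoment W k (testFn W k) ≠ 0 := by
  have ⟨hρ, hu, hθ, _⟩ := hW
  obtain ⟨k, hk⟩ := k
  match k with
  | 0 =>
    rw [testFn, derivMoment_cosh hu hθ hM (by simp)]
    norm_num
  | 1 => exact derivMoment_velocity_ne_zero hM hW rfl
  | 2 => exact derivMoment_temperature_ne_zero hρ hu hθ (by omega) (by omega) rfl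
  | 3 =>
    rw [testFn, ← pow_zero Real.cosh, derivMoment_cosh_pow hu hθ zero_le_two M.zero_le le_rfl]
    norm_num
  | 4 =>
    rw [testFn, ← one_mul Real.sinh, ← pow_zero Real.cosh,
      derivMoment_cosh_pow_mul_sinh hu hθ zero_le_one hM (by simp)]
    norm_num
  | k + 5 => simp [testFn, derivMoment_mode hu hθ (k := ⟨k + 5, hk⟩)]

theorem isUnit_derivMatrix (hM : 1 ≤ M) (hW : Admissible W) : IsUnit (derivMatrix M W) := by
  rw [← mulVec_injective_iff_isUnit, ← coe_mulVecLin, injective_iff_map_eq_zero]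
  intro c hc
  refine eq_zero_of_mulVec_eq_zero_of_blockTriangular
    (T := of fun k j : Fin (2 * M + 1) => derivMoment W j (testFn W k))
    ((Equiv.swap 0 1).injective.comp Fin.val_injective)
    (fun k j => derivMoment_testFn_eq_zero hM hW)
    (derivMoment_testFn_self_ne_zero hM hW) ?_
  ext k
  exact derivMoment_dotProduct_eq_zero hW.2.1 hW.2.2.1 hc (testFn_mem_laurent hM W k)

theorem isUnit_B0 (hM : 1 ≤ M) (hW : Admissible W) : IsUnit (B0 M W) := by
  rw [B0_eq_gram_cosh_mul hW.2.1 hW.2.2.1]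
  exact (gram_posDef (inv_pos.mpr hW.2.2.1) (cosh_add_mem_expAlgebra _)
    fun x => Real.cosh_pos _).isUnit.mul (isUnit_derivMatrix hM hW)

theorem exists_B0_inv_mul_B1_eq_conj_diagonal (hM : 1 ≤ M) (hW : Admissible W) :
    ∃ (P : (Matrix (Fin (2 * M + 1)) (Fin (2 * M + 1)) ℝ)ˣ) (d : Fin (2 * M + 1) → ℝ),
      Function.Injective d ∧ (∀ i, |d i| < 1) ∧
        (B0 M W)⁻¹ * B1 M W = P⁻¹ * diagonal d * P := by
  rw [B0_eq_gram_cosh_mul hW.2.1 hW.2.2.1, B1_eq_gram_sinh_mul hW.2.1 hW.2.2.1]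
  exact exists_gram_inv_mul_eq_conj_diagonal (inv_pos.mpr hW.2.2.1) _ (isUnit_derivMatrix hM hW)

end Invertibility

end

end RelMoment

theorem mainTheorem1 (M : ℕ) (hM : 1 ≤ M) :
    RelMoment.IsStrictlyHyperbolicOn (RelMoment.B0 M) (RelMoment.B1 M)
      {W | RelMoment.Admissible W} ∧
    ∀ W : Fin (2 * M + 1) → ℝ, RelMoment.Admissible W →
      spectralRadius ℂ
        (((RelMoment.B0 M W)⁻¹ * RelMoment.B1 M W).map (algebraMap ℝ ℂ)) < 1 := by
  refine ⟨fun W hW => ⟨RelMoment.isUnit_B0 hM hW, ?_⟩, fun W hW => ?_⟩ <;>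
    obtain ⟨P, d, hd, hlt, hP⟩ := RelMoment.exists_B0_inv_mul_B1_eq_conj_diagonal hM hW <;>
    rw [hP]
  · exact RelMoment.exists_strictMono_hasEigenvalue hd (RelMoment.spectrum_conj_diagonal P d)
  · exact RelMoment.spectralRadius_map_conj_diagonal_lt_one P hlt
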